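/- **Kinds and types.** Kinds are $K ::= \star \mid K\to K'$. Church-style types are $A ::= X_A \mid T_\star \mid A\to B \mid \forall X\le A{:}K.\,B \mid \Lambda X{:}K.\,A \mid A(B)$, where every variable $X_A$ carries a bound $A$; Curry-style (traditional) types are the same with plain variables $X$ instead of $X_A$. Types are identified up to renaming of bound variables. Put $T_{K\to K'}=\Lambda X{:}K.\,T_{K'}$. Contexts are $()$ and $\Gamma, X\le A{:}K$, and $X{:}K$ abbreviates $X\le T_K{:}K$. Substitution $A[B/X]$ is capture-avoiding; on Church variables $X_C[B/X]=B$ and $Y_C[B/X]=Y_{C[B/X]}$ for $Y\ne X$. "$\Gamma\vdash A=B:K$" means $\Gamma\vdash A\le B:K$ and $\Gamma\vdash B\le A:K$. **Church-style system** (kinding $\Gamma\vdash A:K$ and subtyping $\Gamma\vdash A\le B:K$, defined simultaneously by the following rules). - $()\vdash T_\star:\star$. - If $\Gamma\vdash A:K$ and $X\notin\mathrm{dom}(\Gamma)$, then $\Gamma,X\le A{:}K\vdash T_\star:\star$. - If $\Gamma\vdash B:K$, $\Gamma\vdash A\le B:K$ and $X\le A{:}K\in\Gamma$, then $\Gamma\vdash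 X_B:K$. - If $\Gamma,X{:}K\vdash A:K'$, then $\Gamma\vdash\Lambda X{:}K.A:K\to K'$. - If $\Gamma\vdash A:K\to K'$ and $\Gamma\vdash B:K$, then $\Gamma\vdash A(B):K'$. - If $\Gamma\vdash A:\star$ and $\Gamma\vdash B:\star$, then $\Gamma\vdash A\to B:\star$. - If $\Gamma,X\le A{:}K\vdash B:\star$, then $\Gamma\vdash\forall X\le A{:}K.B:\star$. - If $\Gamma\vdash A:K$, then $\Gamma\vdash A\le A:K$ and $\Gamma\vdash A\le T_K:K$. - If $\Gamma\vdash A\le B:K$ and $\Gamma\vdash B\le C:K$, then $\Gamma\vdash A\le C:K$. - If $\Gamma\vdash A\le B:K$, $\Gamma\vdash B=C:K$ and $X\le A{:}K\in\Gamma$, then $\Gamma\vdash X_B\le X_C:K$. - If $\Gamma\vdash A\le B:K$, $\Gamma\vdash B:K$ and $X\le A{:}K\in\Gamma$, then $\Gamma\vdash X_B\le B:K$. - If $\Gamma,X{:}K\vdash A\le B:K'$, then $\Gamma\vdash\Lambda X{:}K.A\le\Lambda X{:}K.B:K\to K'$. - If $\Gamma\vdash A\le C:K\to K'$ and $\Gamma\vdash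 B=D:K$, then $\Gamma\vdash A(B)\le C(D):K'$. - If $\Gamma\vdash B_1\le A_1:\star$ and $\Gamma\vdash A_2\le B_2:\star$, then $\Gamma\vdash A_1\to A_2\le B_1\to B_2:\star$. - If $\Gamma\vdash A=C:K$ and $\Gamma,X\le A{:}K\vdash B\le D:\star$, then $\Gamma\vdash\forall X\le A{:}K.B\le\forall X\le C{:}K.D:\star$. - If $\Gamma,X{:}K\vdash A:K'$ and $\Gamma\vdash B:K$, then $\Gamma\vdash(\Lambda X{:}K.A)(B)\le A[B/X]:K'$ and $\Gamma\vdash A[B/X]\le(\Lambda X{:}K.A)(B):K'$. **Curry-style system.** Kinding $\Gamma\vdash_T A:K$ has the kinding rules above, except that the variable rule reads: if $\Gamma\vdash_T T_\star:\star$ (that is, $\Gamma$ is well formed) and $X\le A{:}K\in\Gamma$, then $\Gamma\vdash_T X:K$. Subtyping $\Gamma\vdash_T A\le B$ is defined by the following rules, where $=_\beta$ is $\beta$-equality, the equivalence relation generated by $\beta$-reduction in arbitrary position. - If $\Gamma\vdash_T A:K$, $\Gamma\vdash_T B:K$ and $A=_\beta B$, then $\Gamma\vdash_T A\le B$. - If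 $\Gamma\vdash_T A\le B$ and $\Gamma\vdash_T B\le C$, then $\Gamma\vdash_T A\le C$. - If $\Gamma\vdash_T A:K$, then $\Gamma\vdash_T A\le T_K$. - If $\Gamma\vdash_T T_\star:\star$ and $X\le A{:}K\in\Gamma$, then $\Gamma\vdash_T X\le A$. - If $\Gamma,X{:}K\vdash_T A\le B$, then $\Gamma\vdash_T\Lambda X{:}K.A\le\Lambda X{:}K.B$. - If $\Gamma\vdash_T A\le B$ and $\Gamma\vdash_T A(C):K$, then $\Gamma\vdash_T A(C)\le B(C)$. - If $\Gamma\vdash_T B_1\le A_1$, $\Gamma\vdash_T A_2\le B_2$ and $\Gamma\vdash_T A_1\to A_2:\star$, then $\Gamma\vdash_T A_1\to A_2\le B_1\to B_2$. - If $\Gamma,X\le A{:}K\vdash_T B\le D$ and $\Gamma\vdash_T\forall X\le A{:}K.B:\star$, then $\Gamma\vdash_T\forall X\le A{:}K.B\le\forall X\le A{:}K.D$. **Erasure** $|\cdot|$ maps Church types to Curry types by $|X_A|=X$ and homomorphically on all other constructors; on contexts, $|()|=()$ and $|\Gamma,X\le A{:}K|=|\Gamma|,X\le|A|{:}K$. **Lemma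 (Completeness).** For all Church-style contexts $\Gamma$, Church-style types $A,B$ and kinds $K$: 1. If $\Gamma\vdash A:K$, then $|\Gamma|\vdash_T|A|:K$. 2. If $\Gamma\vdash A\le B:K$, then $|\Gamma|\vdash_T|A|\le|B|$, $|\Gamma|\vdash_T|A|:K$ and $|\Gamma|\vdash_T|B|:K$. -/

import Mathlib

/-! Types are represented up to renaming of bound variables by de Bruijn indices: index `0` is the
most recently declared variable, and a context lists its most recent declaration first. -/

namespace FOmegaSub

/-- Kinds: `⋆` and `K → K'`. -/
inductive Kind : Type
  | star : Kind
  | arr : Kind → Kind → Kind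

/-! ### The Church-style system: every variable carries its bound -/

namespace Church

/-- Types of the Church-style system; `var x A` is the variable `X_A`, `all A K B` is
`∀ X ≤ A : K. B` and `lam K A` is `Λ X : K. A`, where `all` and `lam` bind a variable in their
last argument. -/
inductive Ty : Type
  | var : ℕ → Ty → Ty
  | top : Ty
  | arrow : Ty → Ty → Ty
  | all : Ty → Kind → Ty → Ty
  | lam : Kind → Ty → Ty
  | app : Ty → Ty → Ty

/-- Lift a renaming under a binder. -/
def liftRen (ρ : ℕ → ℕ) : ℕ → ℕ
  | 0 => 0
  | n + 1 => ρ n + 1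

/-- Renaming of variables. It renames inside the bounds carried by variables as well. -/
def Ty.rename : Ty → (ℕ → ℕ) → Ty
  | .var x A, ρ => .var (ρ x) (A.rename ρ)
  | .top, _ => .top
  | .arrow A B, ρ => .arrow (A.rename ρ) (B.rename ρ)
  | .all A K B, ρ => .all (A.rename ρ) K (B.rename (liftRen ρ))
  | .lam K A, ρ => .lam K (A.rename (liftRen ρ))
  | .app A B, ρ => .app (A.rename ρ) (B.rename ρ)

/-- Weakening by one variable. -/
def Ty.shift (A : Ty) : Ty := A.rename Nat.succ

/-- Parallel substitutions: each variable is either renamed to a variable (`Sum.inl`, written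
`[X ← Y]`) or replaced by a type (`Sum.inr`, written `[A / X]`). -/
abbrev PSubst : Type := ℕ → ℕ ⊕ Ty

/-- Lift a parallel substitution under a binder. -/
def PSubst.lift (γ : PSubst) : PSubst
  | 0 => Sum.inl 0
  | n + 1 => Sum.map Nat.succ Ty.shift (γ n)

/-- Application of a parallel substitution: `X_A[γ]` is `Y_{A[γ]}` if `γ` renames `X` to `Y`, and
it is `B` if `γ` replaces `X` by the type `B`. -/
def Ty.subst : Ty → PSubst → Ty
  | .var x A, γ =>
    match γ x with
    | Sum.inl y => .var y (A.subst γ)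
    | Sum.inr B => B
  | .top, _ => .top
  | .arrow A B, γ => .arrow (A.subst γ) (B.subst γ)
  | .all A K B, γ => .all (A.subst γ) K (B.subst γ.lift)
  | .lam K A, γ => .lam K (A.subst γ.lift)
  | .app A B, γ => .app (A.subst γ) (B.subst γ)

/-- The parallel substitution `[B / X]` for the most recent variable `X`. It renames the other
variables to themselves, that is, it lowers their indices by one. -/
def PSubst.single (B : Ty) : PSubst
  | 0 => Sum.inr B
  | n + 1 => Sum.inl n

/-- `A[B / X]` for the most recent variable `X` of `A`. -/
def Ty.inst (A B : Ty) : Ty := A.subst (PSubst.single B)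

/-- The top type `T_K` at kind `K`: `T_⋆` and `T_{K → K'} = Λ X : K. T_{K'}`. -/
def topAt : Kind → Ty
  | .star => .top
  | .arr K K' => .lam K (topAt K')

/-- Contexts: `(A, K) :: Γ` is `Γ, X ≤ A : K`. -/
abbrev Ctx : Type := List (Ty × Kind)

/-- `Declares Γ x A K` means `X ≤ A : K ∈ Γ`, with `A` regarded as a type over all of `Γ`. -/
inductive Declares : Ctx → ℕ → Ty → Kind → Prop
  | here {Γ : Ctx} {A : Ty} {K : Kind} : Declares ((A, K) :: Γ) 0 A.shift K
  | there {Γ : Ctx} {x : ℕ} {A : Ty} {K : Kind} {d : Ty × Kind} :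
      Declares Γ x A K → Declares (d :: Γ) (x + 1) A.shift K

/-- Statements, the right-hand sides of judgements: `A : K` and `A ≤ B : K`. -/
inductive Stmt : Type
  | kind : Ty → Kind → Stmt
  | sub : Ty → Ty → Kind → Stmt

/-- The judgements `Γ ⊢ A : K` and `Γ ⊢ A ≤ B : K` of the Church-style system, defined
simultaneously. A premise `Γ ⊢ A = B : K` stands for the two premises `Γ ⊢ A ≤ B : K` and
`Γ ⊢ B ≤ A : K`. -/
inductive Derives : Ctx → Stmt → Prop
  | topEmp : Derives [] (.kind .top .star)
  | topExt {Γ : Ctx} {A : Ty} {K : Kind} :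
      Derives Γ (.kind A K) →
      Derives ((A, K) :: Γ) (.kind .top .star)
  | tVar {Γ : Ctx} {x : ℕ} {A B : Ty} {K : Kind} :
      Derives Γ (.kind B K) →
      Derives Γ (.sub A B K) →
      Declares Γ x A K →
      Derives Γ (.kind (.var x B) K)
  | tAbs {Γ : Ctx} {A : Ty} {K K' : Kind} :
      Derives ((topAt K, K) :: Γ) (.kind A K') →
      Derives Γ (.kind (.lam K A) (.arr K K'))
  | tApp {Γ : Ctx} {A B : Ty} {K K' : Kind} :
      Derives Γ (.kind A (.arr K K')) →
      Derives Γ (.kind B K) →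
      Derives Γ (.kind (.app A B) K')
  | arrow {Γ : Ctx} {A B : Ty} :
      Derives Γ (.kind A .star) →
      Derives Γ (.kind B .star) →
      Derives Γ (.kind (.arrow A B) .star)
  | all {Γ : Ctx} {A B : Ty} {K : Kind} :
      Derives ((A, K) :: Γ) (.kind B .star) →
      Derives Γ (.kind (.all A K B) .star)
  | sRefl {Γ : Ctx} {A : Ty} {K : Kind} :
      Derives Γ (.kind A K) →
      Derives Γ (.sub A A K)
  | sTrans {Γ : Ctx} {A B C : Ty} {K : Kind} :
      Derives Γ (.sub A B K) →
      Derives Γ (.sub B C K) →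
      Derives Γ (.sub A C K)
  | sTop {Γ : Ctx} {A : Ty} {K : Kind} :
      Derives Γ (.kind A K) →
      Derives Γ (.sub A (topAt K) K)
  | sTVar {Γ : Ctx} {x : ℕ} {A B C : Ty} {K : Kind} :
      Derives Γ (.sub A B K) →
      Derives Γ (.sub B C K) →
      Derives Γ (.sub C B K) →
      Declares Γ x A K →
      Derives Γ (.sub (.var x B) (.var x C) K)
  | sPromote {Γ : Ctx} {x : ℕ} {A B : Ty} {K : Kind} :
      Derives Γ (.sub A B K) →
      Derives Γ (.kind B K) →
      Declares Γ x A K →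
      Derives Γ (.sub (.var x B) B K)
  | sTAbs {Γ : Ctx} {A B : Ty} {K K' : Kind} :
      Derives ((topAt K, K) :: Γ) (.sub A B K') →
      Derives Γ (.sub (.lam K A) (.lam K B) (.arr K K'))
  | sTApp {Γ : Ctx} {A B C D : Ty} {K K' : Kind} :
      Derives Γ (.sub A C (.arr K K')) →
      Derives Γ (.sub B D K) →
      Derives Γ (.sub D B K) →
      Derives Γ (.sub (.app A B) (.app C D) K')
  | sArrow {Γ : Ctx} {A₁ A₂ B₁ B₂ : Ty} :
      Derives Γ (.sub B₁ A₁ .star) →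
      Derives Γ (.sub A₂ B₂ .star) →
      Derives Γ (.sub (.arrow A₁ A₂) (.arrow B₁ B₂) .star)
  | sAll {Γ : Ctx} {A B C D : Ty} {K : Kind} :
      Derives Γ (.sub A C K) →
      Derives Γ (.sub C A K) →
      Derives ((A, K) :: Γ) (.sub B D .star) →
      Derives Γ (.sub (.all A K B) (.all C K D) .star)
  | sBetaL {Γ : Ctx} {A B : Ty} {K K' : Kind} :
      Derives ((topAt K, K) :: Γ) (.kind A K') →
      Derives Γ (.kind B K) →
      Derives Γ (.sub (.app (.lam K A) B) (A.inst B) K')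
  | sBetaR {Γ : Ctx} {A B : Ty} {K K' : Kind} :
      Derives ((topAt K, K) :: Γ) (.kind A K') →
      Derives Γ (.kind B K) →
      Derives Γ (.sub (A.inst B) (.app (.lam K A) B) K')

/-- `Γ ⊢ A : K`. -/
abbrev HasKind (Γ : Ctx) (A : Ty) (K : Kind) : Prop := Derives Γ (.kind A K)

/-- `Γ ⊢ A ≤ B : K`. -/
abbrev Sub (Γ : Ctx) (A B : Ty) (K : Kind) : Prop := Derives Γ (.sub A B K)

end Church

/-! ### The traditional, Curry-style system: variables without bounds -/

namespace Curry

/-- Types of the traditional system. -/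
inductive Ty : Type
  | var : ℕ → Ty
  | top : Ty
  | arrow : Ty → Ty → Ty
  | all : Ty → Kind → Ty → Ty
  | lam : Kind → Ty → Ty
  | app : Ty → Ty → Ty

/-- Lift a renaming under a binder. -/
def liftRen (ρ : ℕ → ℕ) : ℕ → ℕ
  | 0 => 0
  | n + 1 => ρ n + 1

/-- Renaming of variables. -/
def Ty.rename : Ty → (ℕ → ℕ) → Ty
  | .var x, ρ => .var (ρ x)
  | .top, _ => .top
  | .arrow A B, ρ => .arrow (A.rename ρ) (B.rename ρ)
  | .all A K B, ρ => .all (A.rename ρ) K (B.rename (liftRen ρ))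
  | .lam K A, ρ => .lam K (A.rename (liftRen ρ))
  | .app A B, ρ => .app (A.rename ρ) (B.rename ρ)

/-- Weakening by one variable. -/
def Ty.shift (A : Ty) : Ty := A.rename Nat.succ

/-- Lift a substitution under a binder. -/
def liftSubst (σ : ℕ → Ty) : ℕ → Ty
  | 0 => .var 0
  | n + 1 => (σ n).shift

/-- Capture-avoiding simultaneous substitution. -/
def Ty.subst : Ty → (ℕ → Ty) → Ty
  | .var x, σ => σ x
  | .top, _ => .top
  | .arrow A B, σ => .arrow (A.subst σ) (B.subst σ)
  | .all A K B, σ => .all (A.subst σ) K (B.subst (liftSubst σ))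
  | .lam K A, σ => .lam K (A.subst (liftSubst σ))
  | .app A B, σ => .app (A.subst σ) (B.subst σ)

/-- The substitution `[B / X]` for the most recent variable `X`. -/
def single (B : Ty) : ℕ → Ty
  | 0 => B
  | n + 1 => .var n

/-- `A[B / X]` for the most recent variable `X` of `A`. -/
def Ty.inst (A B : Ty) : Ty := A.subst (single B)

/-- The top type `T_K` at kind `K`. -/
def topAt : Kind → Ty
  | .star => .top
  | .arr K K' => .lam K (topAt K')

/-- One-step `β`-reduction, anywhere in a type. -/
inductive Beta : Ty → Ty → Prop
  | beta {K : Kind} {A B : Ty} : Beta (.app (.lam K A) B) (A.inst B)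
  | arrowL {A A' B : Ty} : Beta A A' → Beta (.arrow A B) (.arrow A' B)
  | arrowR {A B B' : Ty} : Beta B B' → Beta (.arrow A B) (.arrow A B')
  | allL {A A' B : Ty} {K : Kind} : Beta A A' → Beta (.all A K B) (.all A' K B)
  | allR {A B B' : Ty} {K : Kind} : Beta B B' → Beta (.all A K B) (.all A K B')
  | lam {K : Kind} {A A' : Ty} : Beta A A' → Beta (.lam K A) (.lam K A')
  | appL {A A' B : Ty} : Beta A A' → Beta (.app A B) (.app A' B)
  | appR {A B B' : Ty} : Beta B B' → Beta (.app A B) (.app A B')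

/-- `β`-equality: the equivalence relation generated by `β`-reduction. -/
def BetaEq : Ty → Ty → Prop := Relation.EqvGen Beta

/-- Contexts: `(A, K) :: Γ` is `Γ, X ≤ A : K`. -/
abbrev Ctx : Type := List (Ty × Kind)

/-- `Declares Γ x A K` means `X ≤ A : K ∈ Γ`, with `A` regarded as a type over all of `Γ`. -/
inductive Declares : Ctx → ℕ → Ty → Kind → Prop
  | here {Γ : Ctx} {A : Ty} {K : Kind} : Declares ((A, K) :: Γ) 0 A.shift K
  | there {Γ : Ctx} {x : ℕ} {A : Ty} {K : Kind} {d : Ty × Kind} :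
      Declares Γ x A K → Declares (d :: Γ) (x + 1) A.shift K

/-- The kinding judgement `Γ ⊢_T A : K`. The judgement `Γ ⊢_T T_⋆ : ⋆` also expresses that `Γ` is
well formed. -/
inductive HasKind : Ctx → Ty → Kind → Prop
  | topEmp : HasKind [] .top .star
  | topExt {Γ : Ctx} {A : Ty} {K : Kind} :
      HasKind Γ A K →
      HasKind ((A, K) :: Γ) .top .star
  | tVar {Γ : Ctx} {x : ℕ} {A : Ty} {K : Kind} :
      HasKind Γ .top .star →
      Declares Γ x A K →
      HasKind Γ (.var x) K
  | tAbs {Γ : Ctx} {A : Ty} {K K' : Kind} :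
      HasKind ((topAt K, K) :: Γ) A K' →
      HasKind Γ (.lam K A) (.arr K K')
  | tApp {Γ : Ctx} {A B : Ty} {K K' : Kind} :
      HasKind Γ A (.arr K K') →
      HasKind Γ B K →
      HasKind Γ (.app A B) K'
  | arrow {Γ : Ctx} {A B : Ty} :
      HasKind Γ A .star →
      HasKind Γ B .star →
      HasKind Γ (.arrow A B) .star
  | all {Γ : Ctx} {A B : Ty} {K : Kind} :
      HasKind ((A, K) :: Γ) B .star →
      HasKind Γ (.all A K B) .star

/-- The subtyping judgement `Γ ⊢_T A ≤ B`. -/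
inductive Sub : Ctx → Ty → Ty → Prop
  | conv {Γ : Ctx} {A B : Ty} {K : Kind} :
      HasKind Γ A K →
      HasKind Γ B K →
      BetaEq A B →
      Sub Γ A B
  | trans {Γ : Ctx} {A B C : Ty} :
      Sub Γ A B →
      Sub Γ B C →
      Sub Γ A C
  | top {Γ : Ctx} {A : Ty} {K : Kind} :
      HasKind Γ A K →
      Sub Γ A (topAt K)
  | tVar {Γ : Ctx} {x : ℕ} {A : Ty} {K : Kind} :
      HasKind Γ .top .star →
      Declares Γ x A K →
      Sub Γ (.var x) A
  | tAbs {Γ : Ctx} {A B : Ty} {K : Kind} :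
      Sub ((topAt K, K) :: Γ) A B →
      Sub Γ (.lam K A) (.lam K B)
  | tApp {Γ : Ctx} {A B C : Ty} {K : Kind} :
      Sub Γ A B →
      HasKind Γ (.app A C) K →
      Sub Γ (.app A C) (.app B C)
  | arrow {Γ : Ctx} {A₁ A₂ B₁ B₂ : Ty} :
      Sub Γ B₁ A₁ →
      Sub Γ A₂ B₂ →
      HasKind Γ (.arrow A₁ A₂) .star →
      Sub Γ (.arrow A₁ A₂) (.arrow B₁ B₂)
  | all {Γ : Ctx} {A B D : Ty} {K : Kind} :
      Sub ((A, K) :: Γ) B D →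
      HasKind Γ (.all A K B) .star →
      Sub Γ (.all A K B) (.all A K D)

end Curry

/-! ### Erasure -/

/-- Erasure `|A|` strips the bounds from the variables of a type. -/
def Church.Ty.erase : Church.Ty → Curry.Ty
  | .var x _ => .var x
  | .top => .top
  | .arrow A B => .arrow A.erase B.erase
  | .all A K B => .all A.erase K B.erase
  | .lam K A => .lam K A.erase
  | .app A B => .app A.erase B.erase

/-- Erasure `|Γ|` of contexts. -/
def Church.Ctx.erase (Γ : Church.Ctx) : Curry.Ctx :=
  List.map (fun d => (d.1.erase, d.2)) Γ

end FOmegaSub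

/-! The proof is a simultaneous induction on Church-style derivations. After erasure most rules are
immediate. The difficulty lies in the rules for application and for `∀`: they relate arguments or
bounds that are equal in the sense of mutual subtyping, whereas the traditional rules keep the
argument or the bound fixed and can change it only by β-conversion. The theorem thus rests on
antisymmetry of traditional subtyping up to β-equality, `Curry.Sub.antisymm`.

For antisymmetry, `Sub` is embedded (`Sub.le`) into a relation `Le` without a transitivity rule, in
which every rule works up to β-equality. Confluence keeps the shapes of types apart, so derivations
can be inverted; `Le.trans` and `Le.app` then make transitivity and application admissible. In
`Le.antisymm` the structural rules go by induction. The critical case is promotion: if `N` promotes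
to `P` and `P ≤ B ≤ N`, then `N` reaches itself by a nonempty chain of promotions.

Such cycles do not exist. Bounds mention only earlier variables, but after a promotion a β-step may
bring an argument into head position, so the order of the variables alone does not suffice. A
reducibility argument in the style of Tait (`Reducible`) shows that promotion up to β terminates on
well-kinded types. Only confluence of β is needed, not normalization. -/

namespace FOmegaSub.Curry

/-! ### Renaming and substitution -/

theorem liftSubst_var : liftSubst Ty.var = Ty.var := by
  funext x; cases x <;> rfl

theorem liftSubst_var_comp (ρ : ℕ → ℕ) :
    liftSubst (fun x => .var (ρ x)) = fun x => .var (liftRen ρ x) := by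
  funext x; cases x <;> rfl

theorem liftSubst_comp_liftRen (σ : ℕ → Ty) (ρ : ℕ → ℕ) :
    (fun x => liftSubst σ (liftRen ρ x)) = liftSubst (fun x => σ (ρ x)) := by
  funext x; cases x <;> rfl

namespace Ty

theorem subst_var (A : Ty) : A.subst .var = A := by
  induction A <;> simp_all [subst, liftSubst_var]

theorem rename_eq_subst (A : Ty) (ρ : ℕ → ℕ) : A.rename ρ = A.subst (fun x => .var (ρ x)) := by
  induction A generalizing ρ <;> simp_all [subst, rename, liftSubst_var_comp]

theorem subst_rename (A : Ty) (ρ : ℕ → ℕ) (σ : ℕ → Ty) :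
    (A.rename ρ).subst σ = A.subst (fun x => σ (ρ x)) := by
  induction A generalizing ρ σ <;> simp_all [subst, rename, liftSubst_comp_liftRen]

theorem rename_rename (A : Ty) (ρ ρ' : ℕ → ℕ) :
    (A.rename ρ).rename ρ' = A.rename (fun x => ρ' (ρ x)) := by
  rw [rename_eq_subst _ ρ', subst_rename, ← rename_eq_subst]

end Ty

theorem rename_liftSubst (σ : ℕ → Ty) (ρ : ℕ → ℕ) :
    (fun x => (liftSubst σ x).rename (liftRen ρ)) = liftSubst (fun x => (σ x).rename ρ) := by
  funext x
  cases x with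
  | zero => rfl
  | succ x => simp [liftSubst, Ty.shift, Ty.rename_rename, liftRen]

namespace Ty

theorem rename_subst (A : Ty) (ρ : ℕ → ℕ) (σ : ℕ → Ty) :
    (A.subst σ).rename ρ = A.subst (fun x => (σ x).rename ρ) := by
  induction A generalizing ρ σ <;> simp_all [subst, rename, rename_liftSubst]

end Ty

theorem subst_liftSubst (σ τ : ℕ → Ty) :
    (fun x => (liftSubst σ x).subst (liftSubst τ)) = liftSubst (fun x => (σ x).subst τ) := by
  funext x
  cases x with
  | zero => rfl
  | succ x => simp [liftSubst, Ty.shift, Ty.subst_rename, Ty.rename_subst]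

namespace Ty

theorem subst_subst (A : Ty) (σ τ : ℕ → Ty) :
    (A.subst σ).subst τ = A.subst (fun x => (σ x).subst τ) := by
  induction A generalizing σ τ <;> simp_all [subst, subst_liftSubst]

theorem shift_inst (A B : Ty) : A.shift.inst B = A := by
  rw [shift, inst, subst_rename]; exact A.subst_var

theorem shift_subst_liftSubst (A : Ty) (σ : ℕ → Ty) :
    A.shift.subst (liftSubst σ) = (A.subst σ).shift := by
  rw [shift, shift, subst_rename, rename_subst]; rfl

/-- The right-hand side is `σ` extended by `B` at index `0`; the abstraction case of
`Reducible.subst` needs this form. -/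
theorem subst_liftSubst_inst (A B : Ty) (σ : ℕ → Ty) :
    (A.subst (liftSubst σ)).inst B = A.subst (fun x => Nat.casesOn x B σ) := by
  rw [inst, subst_subst]
  congr 1
  funext x
  cases x with
  | zero => rfl
  | succ x => exact shift_inst (σ x) B

theorem inst_subst (A B : Ty) (σ : ℕ → Ty) :
    (A.inst B).subst σ = (A.subst (liftSubst σ)).inst (B.subst σ) := by
  rw [subst_liftSubst_inst, inst, subst_subst]
  congr 1
  funext x
  cases x <;> rfl

end Ty

theorem topAt_subst (K : Kind) (σ : ℕ → Ty) : (topAt K).subst σ = topAt K := by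
  induction K generalizing σ <;> simp_all [topAt, Ty.subst]

theorem topAt_shift (K : Kind) : (topAt K).shift = topAt K := by
  rw [Ty.shift, Ty.rename_eq_subst, topAt_subst]

/-! ### Confluence of `β`-reduction -/

/-- Parallel `β`-reduction. -/
inductive Par : Ty → Ty → Prop
  | var {x : ℕ} : Par (.var x) (.var x)
  | top : Par .top .top
  | arrow {A A' B B' : Ty} : Par A A' → Par B B' → Par (.arrow A B) (.arrow A' B')
  | all {A A' B B' : Ty} {K : Kind} : Par A A' → Par B B' → Par (.all A K B) (.all A' K B')
  | lam {K : Kind} {A A' : Ty} : Par A A' → Par (.lam K A) (.lam K A')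
  | app {A A' B B' : Ty} : Par A A' → Par B B' → Par (.app A B) (.app A' B')
  | beta {K : Kind} {A A' B B' : Ty} :
      Par A A' → Par B B' → Par (.app (.lam K A) B) (A'.inst B')

theorem Par.refl (A : Ty) : Par A A := by
  induction A <;> constructor <;> assumption

theorem Par.subst_of_eq {A B : Ty} (h : Par A B) (σ : ℕ → Ty) : Par (A.subst σ) (B.subst σ) := by
  induction h generalizing σ with
  | var => exact .refl _
  | top => exact .top
  | arrow _ _ h₁ h₂ => exact .arrow (h₁ σ) (h₂ σ)
  | all _ _ h₁ h₂ => exact .all (h₁ σ) (h₂ _)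
  | lam _ h₁ => exact .lam (h₁ _)
  | app _ _ h₁ h₂ => exact .app (h₁ σ) (h₂ σ)
  | beta _ _ h₁ h₂ => rw [Ty.inst_subst]; exact .beta (h₁ _) (h₂ σ)

theorem Par.liftSubst {σ τ : ℕ → Ty} (h : ∀ x, Par (σ x) (τ x)) (x : ℕ) :
    Par (liftSubst σ x) (liftSubst τ x) := by
  cases x with
  | zero => exact .var
  | succ x =>
    simp only [Curry.liftSubst, Ty.shift, Ty.rename_eq_subst]
    exact (h x).subst_of_eq _

theorem Par.subst {A B : Ty} (h : Par A B) {σ τ : ℕ → Ty} (hσ : ∀ x, Par (σ x) (τ x)) :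
    Par (A.subst σ) (B.subst τ) := by
  induction h generalizing σ τ with
  | var => exact hσ _
  | top => exact .top
  | arrow _ _ h₁ h₂ => exact .arrow (h₁ hσ) (h₂ hσ)
  | all _ _ h₁ h₂ => exact .all (h₁ hσ) (h₂ (Par.liftSubst hσ))
  | lam _ h₁ => exact .lam (h₁ (Par.liftSubst hσ))
  | app _ _ h₁ h₂ => exact .app (h₁ hσ) (h₂ hσ)
  | beta _ _ h₁ h₂ => rw [Ty.inst_subst]; exact .beta (h₁ (Par.liftSubst hσ)) (h₂ hσ)

theorem Par.inst {A A' B B' : Ty} (hA : Par A A') (hB : Par B B') :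
    Par (A.inst B) (A'.inst B') := by
  refine hA.subst fun x => ?_
  cases x with
  | zero => exact hB
  | succ x => exact .var

/-- The complete development of a type: all its redexes are contracted. -/
def Ty.dev : Ty → Ty
  | .var x => .var x
  | .top => .top
  | .arrow A B => .arrow A.dev B.dev
  | .all A K B => .all A.dev K B.dev
  | .lam K A => .lam K A.dev
  | .app (.lam _ A) B => A.dev.inst B.dev
  | .app A B => .app A.dev B.dev

/-- A parallel step contracts some of the redexes of `A`, and a further step contracts the rest.
Since the target depends on `A` alone, the diamond property follows. -/
theorem Par.dev {A B : Ty} (h : Par A B) : Par B A.dev := by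
  induction h with
  | var => exact .var
  | top => exact .top
  | arrow _ _ h₁ h₂ => exact .arrow h₁ h₂
  | all _ _ h₁ h₂ => exact .all h₁ h₂
  | lam _ h₁ => exact .lam h₁
  | @app A A' B B' h _ h₁ h₂ =>
    -- `dev` contracts the application exactly when its function part is an abstraction; both
    -- reductions of that part are then inverted to reach the bodies.
    cases A with
    | lam K A =>
      cases h with
      | lam h => cases h₁ with | lam h₁ => exact .beta h₁ h₂
    | _ => exact .app h₁ h₂
  | beta _ _ h₁ h₂ => exact h₁.inst h₂

theorem Beta.par {A B : Ty} (h : Beta A B) : Par A B := by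
  induction h with
  | beta => exact .beta (.refl _) (.refl _)
  | arrowL _ h => exact .arrow h (.refl _)
  | arrowR _ h => exact .arrow (.refl _) h
  | allL _ h => exact .all h (.refl _)
  | allR _ h => exact .all (.refl _) h
  | lam _ h => exact .lam h
  | appL _ h => exact .app h (.refl _)
  | appR _ h => exact .app (.refl _) h

namespace BetaEq

theorem refl (A : Ty) : BetaEq A A := Relation.EqvGen.refl A

theorem symm {A B : Ty} (h : BetaEq A B) : BetaEq B A := Relation.EqvGen.symm _ _ h

theorem trans {A B C : Ty} (h : BetaEq A B) (h' : BetaEq B C) : BetaEq A C :=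
  Relation.EqvGen.trans _ _ _ h h'

theorem map (f : Ty → Ty) (hf : ∀ A B, Beta A B → Beta (f A) (f B)) {A B : Ty}
    (h : BetaEq A B) : BetaEq (f A) (f B) := by
  induction h with
  | rel _ _ h => exact .rel _ _ (hf _ _ h)
  | refl => exact refl _
  | symm _ _ _ h => exact h.symm
  | trans _ _ _ _ _ h h' => exact h.trans h'

theorem arrow {A A' B B' : Ty} (hA : BetaEq A A') (hB : BetaEq B B') :
    BetaEq (.arrow A B) (.arrow A' B') :=
  (map (.arrow · B) (fun _ _ => .arrowL) hA).trans (map (.arrow A' ·) (fun _ _ => .arrowR) hB)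

theorem all {A A' B B' : Ty} {K : Kind} (hA : BetaEq A A') (hB : BetaEq B B') :
    BetaEq (.all A K B) (.all A' K B') :=
  (map (.all · K B) (fun _ _ => .allL) hA).trans (map (.all A' K ·) (fun _ _ => .allR) hB)

theorem lam {A A' : Ty} {K : Kind} (hA : BetaEq A A') : BetaEq (.lam K A) (.lam K A') :=
  map (.lam K ·) (fun _ _ => .lam) hA

theorem app {A A' B B' : Ty} (hA : BetaEq A A') (hB : BetaEq B B') :
    BetaEq (.app A B) (.app A' B') :=
  (map (.app · B) (fun _ _ => .appL) hA).trans (map (.app A' ·) (fun _ _ => .appR) hB)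

theorem beta (K : Kind) (A B : Ty) : BetaEq (.app (.lam K A) B) (A.inst B) := .rel _ _ .beta

end BetaEq

theorem Par.betaEq {A B : Ty} (h : Par A B) : BetaEq A B := by
  induction h with
  | var => exact .refl _
  | top => exact .refl _
  | arrow _ _ h₁ h₂ => exact .arrow h₁ h₂
  | all _ _ h₁ h₂ => exact .all h₁ h₂
  | lam _ h₁ => exact .lam h₁
  | app _ _ h₁ h₂ => exact .app h₁ h₂
  | beta _ _ h₁ h₂ => exact (BetaEq.app (.lam h₁) h₂).trans (.beta _ _ _)

/-- Many steps of parallel reduction. -/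
abbrev Pars : Ty → Ty → Prop := Relation.ReflTransGen Par

theorem Pars.confluent {A B C : Ty} (hB : Pars A B) (hC : Pars A C) :
    ∃ D, Pars B D ∧ Pars C D :=
  Relation.church_rosser
    (fun _ _ _ h h' => ⟨_, .single h.dev, .single h'.dev⟩) hB hC

/-- The Church–Rosser property. -/
theorem BetaEq.join {A B : Ty} (h : BetaEq A B) : ∃ C, Pars A C ∧ Pars B C := by
  induction h with
  | rel _ _ h => exact ⟨_, .single h.par, .refl⟩
  | refl => exact ⟨_, .refl, .refl⟩
  | symm _ _ _ ih => obtain ⟨C, h, h'⟩ := ih; exact ⟨C, h', h⟩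
  | trans _ _ _ _ _ ih ih' =>
    obtain ⟨C, h₁, h₂⟩ := ih
    obtain ⟨D, h₃, h₄⟩ := ih'
    obtain ⟨E, h₅, h₆⟩ := h₂.confluent h₃
    exact ⟨E, h₁.trans h₅, h₄.trans h₆⟩

theorem BetaEq.subst {A B : Ty} (h : BetaEq A B) (σ : ℕ → Ty) :
    BetaEq (A.subst σ) (B.subst σ) := by
  induction h with
  | rel _ _ h => exact (h.par.subst_of_eq σ).betaEq
  | refl => exact .refl _
  | symm _ _ _ h => exact h.symm
  | trans _ _ _ _ _ h h' => exact h.trans h'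

/-! ### Shapes of types up to `β`-equality -/

theorem Pars.top_inv {C : Ty} (h : Pars .top C) : C = .top := by
  induction h with
  | refl => rfl
  | tail _ h ih => subst ih; cases h; rfl

theorem Pars.arrow_inv {A B C : Ty} (h : Pars (.arrow A B) C) :
    ∃ A' B', C = .arrow A' B' ∧ BetaEq A A' ∧ BetaEq B B' := by
  induction h with
  | refl => exact ⟨_, _, rfl, .refl _, .refl _⟩
  | tail _ h ih =>
    obtain ⟨A', B', rfl, hA, hB⟩ := ih
    cases h with
    | arrow h₁ h₂ => exact ⟨_, _, rfl, hA.trans h₁.betaEq, hB.trans h₂.betaEq⟩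

theorem Pars.all_inv {A B C : Ty} {K : Kind} (h : Pars (.all A K B) C) :
    ∃ A' B', C = .all A' K B' ∧ BetaEq A A' ∧ BetaEq B B' := by
  induction h with
  | refl => exact ⟨_, _, rfl, .refl _, .refl _⟩
  | tail _ h ih =>
    obtain ⟨A', B', rfl, hA, hB⟩ := ih
    cases h with
    | all h₁ h₂ => exact ⟨_, _, rfl, hA.trans h₁.betaEq, hB.trans h₂.betaEq⟩

theorem Pars.lam_inv {A C : Ty} {K : Kind} (h : Pars (.lam K A) C) :
    ∃ A', C = .lam K A' ∧ BetaEq A A' := by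
  induction h with
  | refl => exact ⟨_, rfl, .refl _⟩
  | tail _ h ih =>
    obtain ⟨A', rfl, hA⟩ := ih
    cases h with
    | lam h₁ => exact ⟨_, rfl, hA.trans h₁.betaEq⟩

/-- The head of a neutral type is a variable. -/
inductive Neutral : Ty → Prop
  | var (x : ℕ) : Neutral (.var x)
  | app {A : Ty} (B : Ty) : Neutral A → Neutral (.app A B)

theorem Neutral.par {A B : Ty} (hA : Neutral A) (h : Par A B) : Neutral B := by
  induction hA generalizing B with
  | var => cases h; exact .var _
  | app _ hA ih =>
    cases h with
    | app h₁ _ => exact .app _ (ih h₁)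
    | beta => cases hA

theorem Neutral.pars {A B : Ty} (hA : Neutral A) (h : Pars A B) : Neutral B := by
  induction h with
  | refl => exact hA
  | tail _ h ih => exact ih.par h

namespace BetaEq

variable {A B C D N : Ty} {K K' : Kind}

theorem arrow_inj (h : BetaEq (.arrow A B) (.arrow C D)) : BetaEq A C ∧ BetaEq B D := by
  obtain ⟨E, h₁, h₂⟩ := h.join
  obtain ⟨_, _, rfl, hA, hB⟩ := h₁.arrow_inv
  obtain ⟨_, _, e, hC, hD⟩ := h₂.arrow_inv
  cases e
  exact ⟨hA.trans hC.symm, hB.trans hD.symm⟩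

theorem all_inj (h : BetaEq (.all A K B) (.all C K' D)) : K = K' ∧ BetaEq A C ∧ BetaEq B D := by
  obtain ⟨E, h₁, h₂⟩ := h.join
  obtain ⟨_, _, rfl, hA, hB⟩ := h₁.all_inv
  obtain ⟨_, _, e, hC, hD⟩ := h₂.all_inv
  cases e
  exact ⟨rfl, hA.trans hC.symm, hB.trans hD.symm⟩

theorem lam_inj (h : BetaEq (.lam K A) (.lam K' B)) : K = K' ∧ BetaEq A B := by
  obtain ⟨E, h₁, h₂⟩ := h.join
  obtain ⟨_, rfl, hA⟩ := h₁.lam_inv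
  obtain ⟨_, e, hC⟩ := h₂.lam_inv
  cases e
  exact ⟨rfl, hA.trans hC.symm⟩

theorem top_ne_arrow : ¬ BetaEq .top (.arrow A B) := fun h => by
  obtain ⟨E, h₁, h₂⟩ := h.join
  obtain rfl := h₁.top_inv
  obtain ⟨_, _, e, _⟩ := h₂.arrow_inv
  cases e

theorem top_ne_all : ¬ BetaEq .top (.all A K B) := fun h => by
  obtain ⟨E, h₁, h₂⟩ := h.join
  obtain rfl := h₁.top_inv
  obtain ⟨_, _, e, _⟩ := h₂.all_inv
  cases e

theorem arrow_ne_all : ¬ BetaEq (.arrow A B) (.all C K D) := fun h => by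
  obtain ⟨E, h₁, h₂⟩ := h.join
  obtain ⟨_, _, rfl, _⟩ := h₁.arrow_inv
  obtain ⟨_, _, e, _⟩ := h₂.all_inv
  cases e

theorem arrow_ne_lam : ¬ BetaEq (.arrow A B) (.lam K C) := fun h => by
  obtain ⟨E, h₁, h₂⟩ := h.join
  obtain ⟨_, _, rfl, _⟩ := h₁.arrow_inv
  obtain ⟨_, e, _⟩ := h₂.lam_inv
  cases e

theorem all_ne_lam : ¬ BetaEq (.all A K B) (.lam K' C) := fun h => by
  obtain ⟨E, h₁, h₂⟩ := h.join
  obtain ⟨_, _, rfl, _⟩ := h₁.all_inv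
  obtain ⟨_, e, _⟩ := h₂.lam_inv
  cases e

theorem top_ne_neutral (hN : Neutral N) : ¬ BetaEq .top N := fun h => by
  obtain ⟨E, h₁, h₂⟩ := h.join
  obtain rfl := h₁.top_inv
  cases hN.pars h₂

theorem arrow_ne_neutral (hN : Neutral N) : ¬ BetaEq (.arrow A B) N := fun h => by
  obtain ⟨E, h₁, h₂⟩ := h.join
  obtain ⟨_, _, rfl, _⟩ := h₁.arrow_inv
  cases hN.pars h₂

theorem all_ne_neutral (hN : Neutral N) : ¬ BetaEq (.all A K B) N := fun h => by
  obtain ⟨E, h₁, h₂⟩ := h.join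
  obtain ⟨_, _, rfl, _⟩ := h₁.all_inv
  cases hN.pars h₂

theorem lam_ne_neutral (hN : Neutral N) : ¬ BetaEq (.lam K A) N := fun h => by
  obtain ⟨E, h₁, h₂⟩ := h.join
  obtain ⟨_, rfl, _⟩ := h₁.lam_inv
  cases hN.pars h₂

theorem topAt_ne_arrow : ¬ BetaEq (topAt K) (.arrow A B) := by
  cases K with
  | star => exact top_ne_arrow
  | arr => exact fun h => arrow_ne_lam h.symm

theorem topAt_ne_all : ¬ BetaEq (topAt K) (.all A K' B) := by
  cases K with
  | star => exact top_ne_all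
  | arr => exact fun h => all_ne_lam h.symm

theorem topAt_ne_neutral (hN : Neutral N) : ¬ BetaEq (topAt K) N := by
  cases K with
  | star => exact top_ne_neutral hN
  | arr => exact lam_ne_neutral hN

theorem topAt_app (K K' : Kind) (B : Ty) : BetaEq (.app (topAt (.arr K K')) B) (topAt K') := by
  have := beta K (topAt K') B
  rwa [Ty.inst, topAt_subst] at this

end BetaEq

/-! ### Kinding relative to the kinds of the variables -/

/-- Kinding that depends only on the kinds of the declared variables and not on their bounds. -/
inductive SimpleKind : List Kind → Ty → Kind → Prop
  | var {Δ : List Kind} {x : ℕ} {K : Kind} : Δ[x]? = some K → SimpleKind Δ (.var x) K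
  | top {Δ : List Kind} : SimpleKind Δ .top .star
  | arrow {Δ : List Kind} {A B : Ty} :
      SimpleKind Δ A .star → SimpleKind Δ B .star → SimpleKind Δ (.arrow A B) .star
  | all {Δ : List Kind} {A B : Ty} {K : Kind} :
      SimpleKind Δ A K → SimpleKind (K :: Δ) B .star → SimpleKind Δ (.all A K B) .star
  | lam {Δ : List Kind} {A : Ty} {K K' : Kind} :
      SimpleKind (K :: Δ) A K' → SimpleKind Δ (.lam K A) (.arr K K')
  | app {Δ : List Kind} {A B : Ty} {K K' : Kind} :
      SimpleKind Δ A (.arr K K') → SimpleKind Δ B K → SimpleKind Δ (.app A B) K'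

namespace SimpleKind

theorem unique {Δ : List Kind} {A : Ty} {K K' : Kind} (h : SimpleKind Δ A K)
    (h' : SimpleKind Δ A K') : K = K' := by
  induction h generalizing K' with
  | var h => cases h' with | var h' => exact Option.some.inj (h.symm.trans h')
  | top => cases h'; rfl
  | arrow => cases h'; rfl
  | all => cases h'; rfl
  | lam _ ih => cases h' with | lam h' => rw [ih h']
  | app _ _ ih => cases h' with | app h' => cases ih h'; rfl

theorem topAt (Δ : List Kind) (K : Kind) : SimpleKind Δ (topAt K) K := by
  induction K generalizing Δ with
  | star => exact .top
  | arr _ _ _ ih => exact .lam (ih _)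

theorem rename {Δ Δ' : List Kind} {A : Ty} {K : Kind} (h : SimpleKind Δ A K) {ρ : ℕ → ℕ}
    (hρ : ∀ x K, Δ[x]? = some K → Δ'[ρ x]? = some K) : SimpleKind Δ' (A.rename ρ) K := by
  have lift {Δ Δ' : List Kind} {ρ : ℕ → ℕ} (hρ : ∀ x K, Δ[x]? = some K → Δ'[ρ x]? = some K)
      (K₀ : Kind) : ∀ x K, (K₀ :: Δ)[x]? = some K → (K₀ :: Δ')[liftRen ρ x]? = some K := by
    rintro (_ | x) K h
    · exact h
    · exact hρ x K h
  induction h generalizing Δ' ρ with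
  | var h => exact .var (hρ _ _ h)
  | top => exact .top
  | arrow _ _ h₁ h₂ => exact .arrow (h₁ hρ) (h₂ hρ)
  | all _ _ h₁ h₂ => exact .all (h₁ hρ) (h₂ (lift hρ _))
  | lam _ h₁ => exact .lam (h₁ (lift hρ _))
  | app _ _ h₁ h₂ => exact .app (h₁ hρ) (h₂ hρ)

theorem shift {Δ : List Kind} {A : Ty} {K : Kind} (h : SimpleKind Δ A K) (K' : Kind) :
    SimpleKind (K' :: Δ) A.shift K := h.rename fun _ _ h => h

theorem liftSubst {Δ Δ' : List Kind} {σ : ℕ → Ty}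
    (hσ : ∀ x K, Δ[x]? = some K → SimpleKind Δ' (σ x) K) (K₀ : Kind) :
    ∀ x K, (K₀ :: Δ)[x]? = some K → SimpleKind (K₀ :: Δ') (liftSubst σ x) K := by
  rintro (_ | x) K h
  · exact .var h
  · exact (hσ x K h).shift _

theorem subst {Δ Δ' : List Kind} {A : Ty} {K : Kind} (h : SimpleKind Δ A K) {σ : ℕ → Ty}
    (hσ : ∀ x K, Δ[x]? = some K → SimpleKind Δ' (σ x) K) : SimpleKind Δ' (A.subst σ) K := by
  induction h generalizing Δ' σ with
  | var h => exact hσ _ _ h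
  | top => exact .top
  | arrow _ _ h₁ h₂ => exact .arrow (h₁ hσ) (h₂ hσ)
  | all _ _ h₁ h₂ => exact .all (h₁ hσ) (h₂ (liftSubst hσ _))
  | lam _ h₁ => exact .lam (h₁ (liftSubst hσ _))
  | app _ _ h₁ h₂ => exact .app (h₁ hσ) (h₂ hσ)

theorem single {Δ : List Kind} {B : Ty} {K₀ : Kind} (hB : SimpleKind Δ B K₀) :
    ∀ x K, (K₀ :: Δ)[x]? = some K → SimpleKind Δ (single B x) K := by
  rintro (_ | x) K h
  · cases h; exact hB
  · exact .var h

theorem inst {Δ : List Kind} {A B : Ty} {K K' : Kind} (hA : SimpleKind (K :: Δ) A K')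
    (hB : SimpleKind Δ B K) : SimpleKind Δ (A.inst B) K' := hA.subst (single hB)

end SimpleKind

/-- The kinds of the variables declared in a context. -/
def Ctx.kinds (Γ : Ctx) : List Kind := List.map Prod.snd Γ

/-- Every bound in the context is well kinded. -/
def Ctx.Wf : Ctx → Prop
  | [] => True
  | (A, K) :: Γ => Ctx.Wf Γ ∧ SimpleKind (Ctx.kinds Γ) A K

theorem Declares.kinds {Γ : Ctx} {x : ℕ} {A : Ty} {K : Kind} (h : Declares Γ x A K) :
    (Ctx.kinds Γ)[x]? = some K := by
  induction h with
  | here => rfl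
  | there _ ih => exact ih

theorem Declares.exists_of_kinds {Γ : Ctx} {x : ℕ} {K : Kind} (h : (Ctx.kinds Γ)[x]? = some K) :
    ∃ A, Declares Γ x A K := by
  induction Γ generalizing x with
  | nil => simp [Ctx.kinds] at h
  | cons d Γ ih =>
    cases x with
    | zero => obtain ⟨A, K₀⟩ := d; cases h; exact ⟨_, .here⟩
    | succ x => obtain ⟨A, h⟩ := ih h; exact ⟨_, .there h⟩

theorem Declares.unique {Γ : Ctx} {x : ℕ} {A A' : Ty} {K K' : Kind} (h : Declares Γ x A K)
    (h' : Declares Γ x A' K') : A = A' := by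
  induction h generalizing A' with
  | here => cases h'; rfl
  | there _ ih => cases h' with | there h' => rw [ih h']

theorem Ctx.Wf.declares {Γ : Ctx} (hΓ : Ctx.Wf Γ) {x : ℕ} {A : Ty} {K : Kind}
    (h : Declares Γ x A K) : SimpleKind (Ctx.kinds Γ) A K := by
  induction h with
  | here => exact hΓ.2.shift _
  | there _ ih => exact (ih hΓ.1).shift _

theorem Ctx.Wf.topExt {Γ : Ctx} (hΓ : Ctx.Wf Γ) (K : Kind) : Ctx.Wf ((topAt K, K) :: Γ) :=
  ⟨hΓ, .topAt _ _⟩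

theorem HasKind.simple {Γ : Ctx} {A : Ty} {K : Kind} (h : HasKind Γ A K) :
    Ctx.Wf Γ ∧ SimpleKind (Ctx.kinds Γ) A K := by
  induction h with
  | topEmp => exact ⟨trivial, .top⟩
  | topExt _ ih => exact ⟨ih, .top⟩
  | tVar _ h ih => exact ⟨ih.1, .var h.kinds⟩
  | tAbs _ ih => exact ⟨ih.1.1, .lam ih.2⟩
  | tApp _ _ ih₁ ih₂ => exact ⟨ih₁.1, .app ih₁.2 ih₂.2⟩
  | arrow _ _ ih₁ ih₂ => exact ⟨ih₁.1, .arrow ih₁.2 ih₂.2⟩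
  | all _ ih => exact ⟨ih.1.1, .all ih.1.2 ih.2⟩

theorem SimpleKind.hasKind_of_top {Δ : List Kind} {A : Ty} {K : Kind} (h : SimpleKind Δ A K)
    {Γ : Ctx} (hΔ : Ctx.kinds Γ = Δ) (hΓ : HasKind Γ .top .star) : HasKind Γ A K := by
  induction h generalizing Γ with
  | var h =>
    subst hΔ
    obtain ⟨A, hA⟩ := Declares.exists_of_kinds h
    exact .tVar hΓ hA
  | top => exact hΓ
  | arrow _ _ h₁ h₂ => exact .arrow (h₁ hΔ hΓ) (h₂ hΔ hΓ)
  | all _ _ h₁ h₂ =>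
    exact .all (h₂ (by rw [← hΔ]; rfl) (.topExt (h₁ hΔ hΓ)))
  | @lam _ A K K' _ h₁ =>
    have top (K : Kind) : ∀ {Γ : Ctx}, HasKind Γ .top .star → HasKind Γ (Curry.topAt K) K := by
      induction K with
      | star => exact fun h => h
      | arr K K' ihK ih => exact fun h => .tAbs (ih (.topExt (ihK h)))
    exact .tAbs (h₁ (by rw [← hΔ]; rfl) (.topExt (top K hΓ)))
  | app _ _ h₁ h₂ => exact .tApp (h₁ hΔ hΓ) (h₂ hΔ hΓ)

/-- In the traditional system bounds affect kinding only through well-formedness of the context.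
With the converse `HasKind.simple`, this reduces substitution and change of bounds to `SimpleKind`.
-/
theorem Ctx.Wf.hasKind {Γ : Ctx} (hΓ : Ctx.Wf Γ) {A : Ty} {K : Kind}
    (h : SimpleKind (Ctx.kinds Γ) A K) : HasKind Γ A K := by
  refine h.hasKind_of_top rfl ?_
  clear h
  induction Γ with
  | nil => exact .topEmp
  | cons d Γ ih => exact .topExt (hΓ.2.hasKind_of_top rfl (ih hΓ.1))

end FOmegaSub.Curry

namespace FOmegaSub.Curry

/-! ### Promotion of the head variable of a neutral type -/

/-- The head variable of a neutral type is replaced by its bound. -/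
inductive Promotes (Γ : Ctx) : Ty → Ty → Prop
  | var {x : ℕ} {A : Ty} {K : Kind} : Declares Γ x A K → Promotes Γ (.var x) A
  | app {A A' : Ty} (B : Ty) : Promotes Γ A A' → Promotes Γ (.app A B) (.app A' B)

namespace Promotes

variable {Γ : Ctx} {N N' P P' : Ty}

theorem neutral (h : Promotes Γ N P) : Neutral N := by
  induction h with
  | var => exact .var _
  | app _ _ ih => exact .app _ ih

theorem unique (h : Promotes Γ N P) (h' : Promotes Γ N P') : P = P' := by
  induction h generalizing P' with
  | var h => cases h' with | var h' => exact h.unique h'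
  | app _ _ ih => cases h' with | app _ h' => rw [ih h']

/-- A neutral type has no redex along its head, so reduction acts only inside the arguments and
commutes with replacing the head. -/
theorem par (h : Promotes Γ N P) (hN : Par N N') : ∃ P', Promotes Γ N' P' ∧ BetaEq P P' := by
  induction h generalizing N' with
  | var h => cases hN; exact ⟨_, .var h, .refl _⟩
  | app _ h ih =>
    cases hN with
    | app h₁ h₂ =>
      obtain ⟨P', hP, e⟩ := ih h₁
      exact ⟨_, .app _ hP, e.app h₂.betaEq⟩
    | beta => cases h

theorem pars (h : Promotes Γ N P) (hN : Pars N N') : ∃ P', Promotes Γ N' P' ∧ BetaEq P P' := by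
  induction hN with
  | refl => exact ⟨_, h, .refl _⟩
  | tail _ hN ih =>
    obtain ⟨P₁, h₁, e₁⟩ := ih
    obtain ⟨P₂, h₂, e₂⟩ := h₁.par hN
    exact ⟨_, h₂, e₁.trans e₂⟩

/-- Both promotions are carried to a common reduct of `N` and `N'`, where promotion is unique. -/
theorem betaEq (h : Promotes Γ N P) (h' : Promotes Γ N' P') (e : BetaEq N N') :
    BetaEq P P' := by
  obtain ⟨M, hM, hM'⟩ := e.join
  obtain ⟨Q, hQ, eQ⟩ := h.pars hM
  obtain ⟨Q', hQ', eQ'⟩ := h'.pars hM'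
  obtain rfl := hQ.unique hQ'
  exact eQ.trans eQ'.symm

theorem simpleKind (h : Promotes Γ N P) (hΓ : Ctx.Wf Γ) {K : Kind}
    (hN : SimpleKind (Ctx.kinds Γ) N K) : SimpleKind (Ctx.kinds Γ) P K := by
  induction h generalizing K with
  | var h =>
    cases hN with
    | var hN =>
      cases hN.symm.trans h.kinds
      exact hΓ.declares h
  | app _ _ ih => cases hN with | app h₁ h₂ => exact .app (ih h₁) h₂

end Promotes

/-! ### Substitutions that respect bounds -/

/-- Every variable is mapped to a variable with the corresponding bound, unless its bound is the
top type; then it may be mapped to an arbitrary type of its kind. -/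
def Respects (Γ Γ' : Ctx) (σ : ℕ → Ty) : Prop :=
  ∀ x A K, Declares Γ x A K → SimpleKind (Ctx.kinds Γ') (σ x) K ∧
    ((∃ y, σ x = .var y ∧ Declares Γ' y (A.subst σ) K) ∨ A = topAt K)

namespace Respects

variable {Γ Γ' : Ctx} {σ : ℕ → Ty}

theorem lift (hσ : Respects Γ Γ' σ) (C : Ty) (K₀ : Kind) :
    Respects ((C, K₀) :: Γ) ((C.subst σ, K₀) :: Γ') (liftSubst σ) := by
  intro x A K h
  cases h with
  | here =>
    refine ⟨.var rfl, .inl ⟨0, rfl, ?_⟩⟩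
    rw [Ty.shift_subst_liftSubst]
    exact .here
  | there h =>
    obtain ⟨hk, h | h⟩ := hσ _ _ _ h
    · obtain ⟨y, e, h⟩ := h
      refine ⟨hk.shift _, .inl ⟨y + 1, by rw [liftSubst, e]; rfl, ?_⟩⟩
      rw [Ty.shift_subst_liftSubst]
      exact .there h
    · exact ⟨hk.shift _, .inr (by rw [h, topAt_shift])⟩

theorem kinds (hσ : Respects Γ Γ' σ) :
    ∀ x K, (Ctx.kinds Γ)[x]? = some K → SimpleKind (Ctx.kinds Γ') (σ x) K := by
  intro x K h
  obtain ⟨A, hA⟩ := Declares.exists_of_kinds h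
  exact (hσ x A K hA).1

theorem single {B : Ty} {K : Kind} (hB : SimpleKind (Ctx.kinds Γ) B K) :
    Respects ((topAt K, K) :: Γ) Γ (single B) := by
  intro x A K' h
  cases h with
  | here => exact ⟨hB, .inr (topAt_shift K)⟩
  | @there _ x A _ _ h =>
    refine ⟨.var h.kinds, .inl ⟨x, rfl, ?_⟩⟩
    change Declares Γ x (A.shift.inst B) K'
    rwa [Ty.shift_inst]

end Respects

/-- If the head is not sent to a variable with the corresponding bound, its bound is a top type;
then `P` is a top type applied to arguments, which β-reduces to the top type at its kind. -/
theorem Promotes.subst {Γ Γ' : Ctx} {σ : ℕ → Ty} {N P : Ty} {K : Kind} (h : Promotes Γ N P)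
    (hσ : Respects Γ Γ' σ) (hN : SimpleKind (Ctx.kinds Γ) N K) :
    Promotes Γ' (N.subst σ) (P.subst σ) ∨ BetaEq P (topAt K) := by
  induction h generalizing K with
  | var h =>
    cases hN with
    | var hN =>
      cases hN.symm.trans h.kinds
      obtain ⟨-, h | h⟩ := hσ _ _ _ h
      · obtain ⟨y, e, h⟩ := h
        rw [Ty.subst, e]
        exact .inl (.var h)
      · exact .inr (h ▸ .refl _)
  | app B _ ih =>
    cases hN with
    | app h₁ h₂ =>
      obtain h | h := ih h₁
      · exact .inl (.app _ h)
      · exact .inr ((h.app (.refl B)).trans (.topAt_app _ _ _))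

/-! ### Syntax-directed subtyping up to `β`-equality -/

/-- Subtyping without a transitivity rule, on well-kinded types up to `β`-equality. The first
argument bounds the height of the derivation. -/
inductive Le : ℕ → Ctx → Ty → Ty → Kind → Prop
  | refl {n : ℕ} {Γ : Ctx} {A B : Ty} {K : Kind} :
      SimpleKind (Ctx.kinds Γ) A K → SimpleKind (Ctx.kinds Γ) B K → BetaEq A B → Le n Γ A B K
  | top {n : ℕ} {Γ : Ctx} {A B : Ty} {K : Kind} :
      SimpleKind (Ctx.kinds Γ) A K → SimpleKind (Ctx.kinds Γ) B K → BetaEq B (topAt K) →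
      Le n Γ A B K
  | promote {n : ℕ} {Γ : Ctx} {A B N P : Ty} {K : Kind} :
      SimpleKind (Ctx.kinds Γ) A K → SimpleKind (Ctx.kinds Γ) N K → BetaEq A N →
      Promotes Γ N P → Le n Γ P B K → Le (n + 1) Γ A B K
  | arrow {n m : ℕ} {Γ : Ctx} {A A₁ A₂ B B₁ B₂ : Ty} :
      SimpleKind (Ctx.kinds Γ) A .star → SimpleKind (Ctx.kinds Γ) B .star →
      BetaEq A (.arrow A₁ A₂) → BetaEq B (.arrow B₁ B₂) →
      Le n Γ B₁ A₁ .star → Le m Γ A₂ B₂ .star → Le (n + m + 1) Γ A B .star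
  | all {n : ℕ} {Γ : Ctx} {A A' B B' C : Ty} {K : Kind} :
      SimpleKind (Ctx.kinds Γ) A .star → SimpleKind (Ctx.kinds Γ) B .star →
      SimpleKind (Ctx.kinds Γ) C K → BetaEq A (.all C K A') → BetaEq B (.all C K B') →
      Le n ((C, K) :: Γ) A' B' .star → Le (n + 1) Γ A B .star
  | lam {n : ℕ} {Γ : Ctx} {A A' B B' : Ty} {K K' : Kind} :
      SimpleKind (Ctx.kinds Γ) A (.arr K K') → SimpleKind (Ctx.kinds Γ) B (.arr K K') →
      BetaEq A (.lam K A') → BetaEq B (.lam K B') →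
      Le n ((topAt K, K) :: Γ) A' B' K' → Le (n + 1) Γ A B (.arr K K')

namespace Le

variable {n m : ℕ} {Γ Γ' : Ctx} {A A' B B' C : Ty} {K K' : Kind}

theorem left (h : Le n Γ A B K) : SimpleKind (Ctx.kinds Γ) A K := by
  cases h <;> assumption

theorem right (h : Le n Γ A B K) : SimpleKind (Ctx.kinds Γ) B K := by
  induction h <;> assumption

/-- Conversion is built into every rule and so costs no height; the induction in `Le.trans` depends
on this. -/
theorem conv_left (h : Le n Γ A B K) (e : BetaEq A' A) (hA : SimpleKind (Ctx.kinds Γ) A' K) :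
    Le n Γ A' B K := by
  cases h with
  | refl _ h₂ e₁ => exact .refl hA h₂ (e.trans e₁)
  | top _ h₂ e₁ => exact .top hA h₂ e₁
  | promote _ h₂ e₁ h₃ h₄ => exact .promote hA h₂ (e.trans e₁) h₃ h₄
  | arrow _ h₂ e₁ e₂ h₃ h₄ => exact .arrow hA h₂ (e.trans e₁) e₂ h₃ h₄
  | all _ h₂ h₃ e₁ e₂ h₄ => exact .all hA h₂ h₃ (e.trans e₁) e₂ h₄
  | lam _ h₂ e₁ e₂ h₃ => exact .lam hA h₂ (e.trans e₁) e₂ h₃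

theorem conv_right (h : Le n Γ A B K) (e : BetaEq B' B) (hB : SimpleKind (Ctx.kinds Γ) B' K) :
    Le n Γ A B' K := by
  induction h with
  | refl h₁ _ e₁ => exact .refl h₁ hB (e₁.trans e.symm)
  | top h₁ _ e₁ => exact .top h₁ hB (e.trans e₁)
  | promote h₁ h₂ e₁ h₃ _ ih => exact .promote h₁ h₂ e₁ h₃ (ih e hB)
  | arrow h₁ _ e₁ e₂ h₃ h₄ => exact .arrow h₁ hB e₁ (e.trans e₂) h₃ h₄
  | all h₁ _ h₃ e₁ e₂ h₄ => exact .all h₁ hB h₃ e₁ (e.trans e₂) h₄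
  | lam h₁ _ e₁ e₂ h₃ => exact .lam h₁ hB e₁ (e.trans e₂) h₃

/-- A top type is not β-equal to a neutral type, an arrow or a `∀`, so only `refl`, `top` and `lam`
can end the derivation. -/
theorem eq_topAt (h : Le n Γ A B K) (e : BetaEq A (topAt K)) : BetaEq B (topAt K) := by
  induction h with
  | refl _ _ e₁ => exact e₁.symm.trans e
  | top _ _ e₁ => exact e₁
  | promote _ _ e₁ h => exact (BetaEq.topAt_ne_neutral h.neutral (e.symm.trans e₁)).elim
  | arrow _ _ e₁ => exact (BetaEq.topAt_ne_arrow (e.symm.trans e₁)).elim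
  | all _ _ _ e₁ => exact (BetaEq.topAt_ne_all (e.symm.trans e₁)).elim
  | lam _ _ e₁ e₂ _ ih => exact e₂.trans (.lam (ih (e₁.symm.trans e).lam_inj.2))

theorem subst (h : Le n Γ A B K) {σ : ℕ → Ty} (hσ : Respects Γ Γ' σ) :
    Le n Γ' (A.subst σ) (B.subst σ) K := by
  induction h generalizing Γ' σ with
  | refl h₁ h₂ e => exact .refl (h₁.subst hσ.kinds) (h₂.subst hσ.kinds) (e.subst σ)
  | top h₁ h₂ e =>
    exact .top (h₁.subst hσ.kinds) (h₂.subst hσ.kinds) (topAt_subst _ σ ▸ e.subst σ)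
  | promote h₁ h₂ e h₃ h₄ ih =>
    obtain h | h := h₃.subst hσ h₂
    · exact .promote (h₁.subst hσ.kinds) (h₂.subst hσ.kinds) (e.subst σ) h (ih hσ)
    -- The promotion is lost, but it led to the top type, so the larger type `B` is top as well.
    · exact .top (h₁.subst hσ.kinds) (h₄.right.subst hσ.kinds)
        (topAt_subst _ σ ▸ (h₄.eq_topAt h).subst σ)
  | arrow h₁ h₂ e₁ e₂ _ _ ih₁ ih₂ =>
    exact .arrow (h₁.subst hσ.kinds) (h₂.subst hσ.kinds) (e₁.subst σ) (e₂.subst σ) (ih₁ hσ) (ih₂ hσ)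
  | all h₁ h₂ h₃ e₁ e₂ _ ih =>
    exact .all (h₁.subst hσ.kinds) (h₂.subst hσ.kinds) (h₃.subst hσ.kinds) (e₁.subst σ)
      (e₂.subst σ) (ih (hσ.lift _ _))
  | @lam _ _ _ _ _ _ K _ h₁ h₂ e₁ e₂ _ ih =>
    refine .lam (h₁.subst hσ.kinds) (h₂.subst hσ.kinds) (e₁.subst σ) (e₂.subst σ) ?_
    have := hσ.lift (topAt K) K
    rw [topAt_subst] at this
    exact ih this

/-- Promotion is compatible with application. Between two abstractions the application is a redex,
and `C` may be substituted into the derivation for the bodies because the bound variable has a top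
bound. -/
theorem app (h : Le n Γ A B (.arr K K')) (hC : SimpleKind (Ctx.kinds Γ) C K) :
    ∃ m, Le m Γ (.app A C) (.app B C) K' := by
  generalize hK : Kind.arr K K' = K₀ at h
  induction h with
  | refl h₁ h₂ e => subst hK; exact ⟨0, .refl (.app h₁ hC) (.app h₂ hC) (e.app (.refl C))⟩
  | top h₁ h₂ e =>
    subst hK
    exact ⟨0, .top (.app h₁ hC) (.app h₂ hC) ((e.app (.refl C)).trans (.topAt_app _ _ _))⟩
  | promote h₁ h₂ e h₃ _ ih =>
    subst hK
    obtain ⟨m, h⟩ := ih hC rfl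
    exact ⟨_, .promote (.app h₁ hC) (.app h₂ hC) (e.app (.refl C)) (.app C h₃) h⟩
  | arrow => cases hK
  | all => cases hK
  | @lam n Γ A A' B B' K K' h₁ h₂ e₁ e₂ h₃ =>
    cases hK
    have h : Le n Γ (A'.inst C) (B'.inst C) K' := h₃.subst (.single hC)
    exact ⟨_, (h.conv_left ((e₁.app (.refl C)).trans (.beta _ _ _)) (.app h₁ hC)).conv_right
      ((e₂.app (.refl C)).trans (.beta _ _ _)) (.app h₂ hC)⟩

end Le

/-- The contexts `Γ` and `Γ'` agree up to `β`-equality of their bounds. -/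
structure CtxEq (Γ Γ' : Ctx) : Prop where
  wf : Ctx.Wf Γ'
  kinds : Ctx.kinds Γ' = Ctx.kinds Γ
  bound {x : ℕ} {A : Ty} {K : Kind} : Declares Γ x A K → ∃ A', Declares Γ' x A' K ∧ BetaEq A A'

theorem CtxEq.refl {Γ : Ctx} (h : Ctx.Wf Γ) : CtxEq Γ Γ := ⟨h, rfl, fun h => ⟨_, h, .refl _⟩⟩

theorem CtxEq.cons {Γ Γ' : Ctx} (h : CtxEq Γ Γ') {C C' : Ty} {K : Kind} (e : BetaEq C C')
    (hC : SimpleKind (Ctx.kinds Γ') C' K) : CtxEq ((C, K) :: Γ) ((C', K) :: Γ') := by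
  refine ⟨⟨h.wf, hC⟩, congrArg (List.cons K) h.kinds, fun hx => ?_⟩
  have shift {A B : Ty} (e : BetaEq A B) : BetaEq A.shift B.shift := by
    rw [Ty.shift, Ty.shift, Ty.rename_eq_subst, Ty.rename_eq_subst]
    exact e.subst _
  cases hx with
  | here => exact ⟨_, .here, shift e⟩
  | there hx =>
    obtain ⟨A', hA', e'⟩ := h.bound hx
    exact ⟨_, .there hA', shift e'⟩

theorem Promotes.ctxEq {Γ Γ' : Ctx} {N P : Ty} (h : Promotes Γ N P) (hΓ : CtxEq Γ Γ') :
    ∃ P', Promotes Γ' N P' ∧ BetaEq P P' := by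
  induction h with
  | var h => obtain ⟨A', h', e⟩ := hΓ.bound h; exact ⟨_, .var h', e⟩
  | app B _ ih => obtain ⟨P', h', e⟩ := ih; exact ⟨_, .app B h', e.app (.refl B)⟩

/-! ### Admissibility of transitivity -/

namespace Le

variable {n m : ℕ} {Γ Γ' : Ctx} {A A' B B' C : Ty} {K K' : Kind}

theorem ctxEq (h : Le n Γ A B K) (hΓ : CtxEq Γ Γ') : Le n Γ' A B K := by
  induction h generalizing Γ' with
  | refl h₁ h₂ e => rw [← hΓ.kinds] at h₁ h₂; exact .refl h₁ h₂ e
  | top h₁ h₂ e => rw [← hΓ.kinds] at h₁ h₂; exact .top h₁ h₂ e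
  | promote h₁ h₂ e h₃ h₄ ih =>
    rw [← hΓ.kinds] at h₁ h₂
    obtain ⟨P', h', e'⟩ := h₃.ctxEq hΓ
    exact .promote h₁ h₂ e h' ((ih hΓ).conv_left e'.symm (h'.simpleKind hΓ.wf h₂))
  | arrow h₁ h₂ e₁ e₂ _ _ ih₁ ih₂ =>
    rw [← hΓ.kinds] at h₁ h₂
    exact .arrow h₁ h₂ e₁ e₂ (ih₁ hΓ) (ih₂ hΓ)
  | all h₁ h₂ h₃ e₁ e₂ _ ih =>
    rw [← hΓ.kinds] at h₁ h₂ h₃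
    exact .all h₁ h₂ h₃ e₁ e₂ (ih (hΓ.cons (.refl _) h₃))
  | lam h₁ h₂ e₁ e₂ _ ih =>
    rw [← hΓ.kinds] at h₁ h₂
    exact .lam h₁ h₂ e₁ e₂ (ih (hΓ.cons (.refl _) (.topAt _ _)))

/-- Induction on the sum of the heights, a measure that is symmetric because contravariance
exchanges the two derivations. If the first ends in a structural rule, the shape of `B` forces the
second to end in `refl`, `top` or the same rule. -/
theorem trans (hΓ : Ctx.Wf Γ) (h : Le n Γ A B K) (h' : Le m Γ B C K) : ∃ k, Le k Γ A C K := by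
  obtain ⟨N, hN⟩ : ∃ N, n + m < N := ⟨_, Nat.lt_succ_self _⟩
  induction N generalizing n m Γ A B C K with
  | zero => omega
  | succ N ih =>
    cases h with
    | refl h₁ _ e => exact ⟨_, h'.conv_left e h₁⟩
    | top h₁ _ e => exact ⟨0, .top h₁ h'.right (h'.eq_topAt e)⟩
    | promote h₁ h₂ e h₃ h₄ =>
      obtain ⟨k, hk⟩ := ih hΓ h₄ h' (by omega)
      exact ⟨_, .promote h₁ h₂ e h₃ hk⟩
    | arrow h₁ h₂ e₁ e₂ h₃ h₄ =>
      cases h' with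
      | refl _ g₂ e => exact ⟨_, (Le.arrow h₁ h₂ e₁ e₂ h₃ h₄).conv_right e.symm g₂⟩
      | top _ g₂ e => exact ⟨0, .top h₁ g₂ e⟩
      | promote _ _ e g => exact (BetaEq.arrow_ne_neutral g.neutral (e₂.symm.trans e)).elim
      | arrow _ g₂ e₃ e₄ g₃ g₄ =>
        obtain ⟨e₅, e₆⟩ := (e₂.symm.trans e₃).arrow_inj
        obtain ⟨k, hk⟩ := ih hΓ (g₃.conv_right e₅ h₃.left) h₃ (by omega)
        obtain ⟨l, hl⟩ := ih hΓ h₄ (g₄.conv_left e₆ h₄.right) (by omega)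
        exact ⟨_, .arrow h₁ g₂ e₁ e₄ hk hl⟩
      | all _ _ _ e => exact (BetaEq.arrow_ne_all (e₂.symm.trans e)).elim
    | all h₁ h₂ h₃ e₁ e₂ h₄ =>
      cases h' with
      | refl _ g₂ e => exact ⟨_, (Le.all h₁ h₂ h₃ e₁ e₂ h₄).conv_right e.symm g₂⟩
      | top _ g₂ e => exact ⟨0, .top h₁ g₂ e⟩
      | promote _ _ e g => exact (BetaEq.all_ne_neutral g.neutral (e₂.symm.trans e)).elim
      | arrow _ _ e => exact (BetaEq.arrow_ne_all (e.symm.trans e₂)).elim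
      | all _ g₂ g₃ e₃ e₄ g₄ =>
        obtain ⟨rfl, e₅, e₆⟩ := (e₂.symm.trans e₃).all_inj
        -- The two bounds are only β-equal, so the second derivation is moved under the first bound,
        -- at the same height.
        have g₅ := g₄.ctxEq ((CtxEq.refl hΓ).cons e₅.symm h₃)
        obtain ⟨k, hk⟩ := ih (Γ := _ :: _) ⟨hΓ, h₃⟩ h₄ (g₅.conv_left e₆ h₄.right) (by omega)
        exact ⟨_, .all h₁ g₂ h₃ e₁ (e₄.trans (.all e₅.symm (.refl _))) hk⟩
    | lam h₁ h₂ e₁ e₂ h₃ =>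
      cases h' with
      | refl _ g₂ e => exact ⟨_, (Le.lam h₁ h₂ e₁ e₂ h₃).conv_right e.symm g₂⟩
      | top _ g₂ e => exact ⟨0, .top h₁ g₂ e⟩
      | promote _ _ e g => exact (BetaEq.lam_ne_neutral g.neutral (e₂.symm.trans e)).elim
      | lam _ g₂ e₃ e₄ g₃ =>
        obtain ⟨-, e₅⟩ := (e₂.symm.trans e₃).lam_inj
        obtain ⟨k, hk⟩ := ih (hΓ.topExt _) h₃ (g₃.conv_left e₅ h₃.right) (by omega)
        exact ⟨_, .lam h₁ g₂ e₁ e₄ hk⟩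

end Le

/-! ### Promotion terminates on well-kinded types -/

/-- Promotion up to `β`-equality. -/
def PromotesEq (Γ : Ctx) (A B : Ty) : Prop :=
  ∃ N P, BetaEq A N ∧ Promotes Γ N P ∧ BetaEq P B

theorem PromotesEq.app {Γ : Ctx} {A B : Ty} (h : PromotesEq Γ A B) (C : Ty) :
    PromotesEq Γ (.app A C) (.app B C) := by
  obtain ⟨N, P, e, h, e'⟩ := h
  exact ⟨_, _, e.app (.refl C), .app C h, e'.app (.refl C)⟩

/-- Reducible types: promotion terminates when they are applied to reducible types. -/
def Reducible (Γ : Ctx) : Kind → Ty → Prop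
  | .star, A => Acc (fun B A => PromotesEq Γ A B) A
  | .arr K K', A => ∀ B, Reducible Γ K B → Reducible Γ K' (.app A B)

namespace Reducible

variable {Γ : Ctx} {A B : Ty} {K K' : Kind}

theorem of_not_neutral (h : ∀ N, Neutral N → ¬ BetaEq A N) : Reducible Γ .star A :=
  Acc.intro _ fun _ ⟨_, _, e, hN, _⟩ => (h _ hN.neutral e).elim

theorem conv (h : Reducible Γ K A) (e : BetaEq A B) : Reducible Γ K B := by
  induction K generalizing A B with
  | star => exact Acc.intro _ fun C ⟨N, P, e₁, hN, e₂⟩ => h.inv ⟨N, P, e.trans e₁, hN, e₂⟩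
  | arr _ _ _ ih => exact fun C hC => ih (h C hC) (e.app (.refl C))

theorem topAt (Γ : Ctx) (K : Kind) : Reducible Γ K (topAt K) := by
  induction K with
  | star => exact of_not_neutral fun _ => BetaEq.top_ne_neutral
  | arr K K' _ ih => exact fun B _ => ih.conv (BetaEq.topAt_app K K' B).symm

/-- At an arrow kind, promotions of `A` induce promotions of `A` applied to a top type, which is a
reducible argument available at every kind. -/
theorem acc (h : Reducible Γ K A) : Acc (fun B A => PromotesEq Γ A B) A := by
  induction K generalizing A with
  | star => exact h
  | arr K K' _ ih =>
    have h' := InvImage.accessible (Ty.app · (Curry.topAt K)) (ih (h _ (.topAt Γ K)))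
    exact Subrelation.accessible (fun h => PromotesEq.app h _) h'

/-- Promotion is unique up to β, so every promotion of `A` leads into the β-class of `B`. -/
theorem of_promotes (h : Promotes Γ A B) (hB : Reducible Γ K B) : Reducible Γ K A := by
  induction K generalizing A B with
  | star =>
    exact Acc.intro _ fun C ⟨N, P, e, hN, e'⟩ => conv (K := .star) hB ((h.betaEq hN e).trans e')
  | arr _ _ _ ih => exact fun C hC => ih (h.app C) (hB C hC)

/-- The fundamental lemma of the logical relation. Arrows and `∀`-types never promote, so their
components impose no condition. -/
theorem subst {Δ : List Kind} (h : SimpleKind Δ A K) {σ : ℕ → Ty}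
    (hσ : ∀ x K, Δ[x]? = some K → Reducible Γ K (σ x)) : Reducible Γ K (A.subst σ) := by
  induction h generalizing σ with
  | var h => exact hσ _ _ h
  | top => exact .topAt _ .star
  | arrow => exact of_not_neutral fun _ => BetaEq.arrow_ne_neutral
  | all => exact of_not_neutral fun _ => BetaEq.all_ne_neutral
  | lam _ ih =>
    intro B hB
    refine conv ?_ (BetaEq.beta _ _ _).symm
    rw [Ty.subst_liftSubst_inst]
    refine ih ?_
    rintro (_ | x) K h
    · cases h; exact hB
    · exact hσ x K h
  | app _ _ ih₁ ih₂ => exact ih₁ hσ _ (ih₂ hσ)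

end Reducible

theorem Ctx.Wf.declares_drop {Γ : Ctx} (hΓ : Ctx.Wf Γ) {x : ℕ} {A : Ty} {K : Kind}
    (h : Declares Γ x A K) : ∃ A₀, A = A₀.rename (· + (x + 1)) ∧
      SimpleKind ((Ctx.kinds Γ).drop (x + 1)) A₀ K := by
  induction h with
  | here => exact ⟨_, rfl, hΓ.2⟩
  | there _ ih =>
    obtain ⟨A₀, rfl, h⟩ := ih hΓ.1
    exact ⟨A₀, Ty.rename_rename _ _ _, h⟩

/-- Induction from the oldest variable onwards: a variable promotes to its bound, whose variables
are all older and hence reducible. -/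
theorem Ctx.Wf.reducible_var {Γ : Ctx} (hΓ : Ctx.Wf Γ) {x : ℕ} {K : Kind}
    (h : (Ctx.kinds Γ)[x]? = some K) : Reducible Γ K (.var x) := by
  obtain ⟨n, hn⟩ : ∃ n, (Ctx.kinds Γ).length - x < n := ⟨_, Nat.lt_succ_self _⟩
  induction n generalizing x K with
  | zero => omega
  | succ n ih =>
    obtain ⟨A, hA⟩ := Declares.exists_of_kinds h
    refine .of_promotes (.var hA) ?_
    obtain ⟨A₀, rfl, hA₀⟩ := hΓ.declares_drop hA
    rw [Ty.rename_eq_subst]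
    refine .subst hA₀ fun y K' hy => ?_
    rw [List.getElem?_drop, Nat.add_comm] at hy
    -- The bound `x < length` makes the truncated difference strictly smaller at the older index.
    have := (List.getElem?_eq_some_iff.1 h).1
    exact ih hy (by omega)

theorem Ctx.Wf.reducible {Γ : Ctx} (hΓ : Ctx.Wf Γ) {A : Ty} {K : Kind}
    (h : SimpleKind (Ctx.kinds Γ) A K) : Reducible Γ K A := by
  have := Reducible.subst h fun x K hx => hΓ.reducible_var hx
  rwa [Ty.subst_var] at this

theorem Ctx.Wf.not_transGen_promotesEq {Γ : Ctx} (hΓ : Ctx.Wf Γ) {A : Ty} {K : Kind}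
    (h : SimpleKind (Ctx.kinds Γ) A K) : ¬ Relation.TransGen (PromotesEq Γ) A A := by
  intro hA
  -- Accessibility is stated for the converse of promotion, so the cycle is reversed.
  have hA' := Relation.transGen_swap.2 hA
  induction (hΓ.reducible h).acc.transGen with
  | intro A _ ih => exact ih A hA' h hA hA'

/-! ### Antisymmetry -/

/-- Below a neutral type only `refl` and promotion are possible. The initial step from `C` makes the
chain nonempty and absorbs the β-conversion in `refl`. -/
theorem Le.transGen_promotesEq {n : ℕ} {Γ : Ctx} {A B C : Ty} {K : Kind} (h : Le n Γ A B K)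
    (hC : PromotesEq Γ C A) (hB : Neutral B) : Relation.TransGen (PromotesEq Γ) C B := by
  induction h generalizing C with
  | refl _ _ e =>
    obtain ⟨N, P, e₁, h, e₂⟩ := hC
    exact .single ⟨N, P, e₁, h, e₂.trans e⟩
  | top _ _ e => exact (BetaEq.topAt_ne_neutral hB e.symm).elim
  | promote _ _ e h _ ih => exact .head hC (ih ⟨_, _, e, h, .refl _⟩ hB)
  | arrow _ _ _ e => exact (BetaEq.arrow_ne_neutral hB e.symm).elim
  | all _ _ _ _ e => exact (BetaEq.all_ne_neutral hB e.symm).elim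
  | lam _ _ _ e => exact (BetaEq.lam_ne_neutral hB e.symm).elim

theorem Le.antisymm {n m : ℕ} {Γ : Ctx} {A B : Ty} {K : Kind} (hΓ : Ctx.Wf Γ)
    (h : Le n Γ A B K) (h' : Le m Γ B A K) : BetaEq A B := by
  induction h generalizing m with
  | refl _ _ e => exact e
  | top _ _ e => exact (h'.eq_topAt e).trans e.symm
  | promote h₁ h₂ e h₃ h₄ =>
    -- From `P ≤ B ≤ N`, with `N` promoting to `P`, a promotion cycle at `N` arises.
    obtain ⟨k, hk⟩ := h₄.trans hΓ (h'.conv_right e.symm h₂)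
    exact (hΓ.not_transGen_promotesEq h₂
      (hk.transGen_promotesEq ⟨_, _, .refl _, h₃, .refl _⟩ h₃.neutral)).elim
  | arrow h₁ h₂ e₁ e₂ h₃ h₄ ih₁ ih₂ =>
    cases h' with
    | refl _ _ e => exact e.symm
    | top _ _ e => exact (BetaEq.topAt_ne_arrow (e.symm.trans e₁)).elim
    | promote _ _ e g => exact (BetaEq.arrow_ne_neutral g.neutral (e₂.symm.trans e)).elim
    | arrow _ _ e₃ e₄ g₃ g₄ =>
      obtain ⟨e₅, e₆⟩ := (e₂.symm.trans e₃).arrow_inj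
      obtain ⟨e₇, e₈⟩ := (e₁.symm.trans e₄).arrow_inj
      have i₁ := ih₁ hΓ ((g₃.conv_left e₇ h₃.right).conv_right e₅ h₃.left)
      have i₂ := ih₂ hΓ ((g₄.conv_left e₆ h₄.right).conv_right e₈ h₄.left)
      exact e₁.trans ((i₁.symm.arrow i₂).trans e₂.symm)
    | all _ _ _ e => exact (BetaEq.arrow_ne_all (e₂.symm.trans e)).elim
  | all h₁ h₂ h₃ e₁ e₂ h₄ ih =>
    cases h' with
    | refl _ _ e => exact e.symm
    | top _ _ e => exact (BetaEq.topAt_ne_all (e.symm.trans e₁)).elim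
    | promote _ _ e g => exact (BetaEq.all_ne_neutral g.neutral (e₂.symm.trans e)).elim
    | arrow _ _ e => exact (BetaEq.arrow_ne_all (e.symm.trans e₂)).elim
    | all _ _ _ e₃ e₄ g₄ =>
      obtain ⟨rfl, e₅, e₆⟩ := (e₂.symm.trans e₃).all_inj
      obtain ⟨-, -, e₈⟩ := (e₁.symm.trans e₄).all_inj
      have g₅ := g₄.ctxEq ((CtxEq.refl hΓ).cons e₅.symm h₃)
      have i := ih ⟨hΓ, h₃⟩ ((g₅.conv_left e₆ h₄.right).conv_right e₈ h₄.left)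
      exact e₁.trans ((BetaEq.all (.refl _) i).trans e₂.symm)
  | lam h₁ h₂ e₁ e₂ h₃ ih =>
    cases h' with
    | refl _ _ e => exact e.symm
    | top _ _ e =>
      -- Here `A` is a top type, so its body is one too, and so is the body of `B` above it.
      have e' := (e.symm.trans e₁).lam_inj.2
      exact e.trans ((e₂.trans (.lam (h₃.eq_topAt e'.symm))).symm)
    | promote _ _ e g => exact (BetaEq.lam_ne_neutral g.neutral (e₂.symm.trans e)).elim
    | lam _ _ e₃ e₄ g₃ =>
      obtain ⟨-, e₅⟩ := (e₂.symm.trans e₃).lam_inj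
      obtain ⟨-, e₆⟩ := (e₁.symm.trans e₄).lam_inj
      have i := ih (hΓ.topExt _) ((g₃.conv_left e₅ h₃.right).conv_right e₆ h₃.left)
      exact e₁.trans ((BetaEq.lam i).trans e₂.symm)

/-- Derivable subtyping in the traditional system is contained in syntax-directed subtyping. -/
theorem Sub.le {Γ : Ctx} {A B : Ty} (h : Sub Γ A B) : Ctx.Wf Γ ∧ ∃ n K, Le n Γ A B K := by
  induction h with
  | conv h₁ h₂ e => exact ⟨h₁.simple.1, 0, _, .refl h₁.simple.2 h₂.simple.2 e⟩
  | trans _ _ ih₁ ih₂ =>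
    obtain ⟨hΓ, n, K, h₁⟩ := ih₁
    obtain ⟨-, m, K', h₂⟩ := ih₂
    -- Traditional subtyping carries no kind; uniqueness of kinds makes the two derivations match.
    obtain rfl := h₁.right.unique h₂.left
    obtain ⟨k, hk⟩ := h₁.trans hΓ h₂
    exact ⟨hΓ, k, K, hk⟩
  | top h => exact ⟨h.simple.1, 0, _, .top h.simple.2 (.topAt _ _) (.refl _)⟩
  | tVar h hx =>
    have hA := h.simple.1.declares hx
    exact ⟨h.simple.1, 1, _, .promote (.var hx.kinds) (.var hx.kinds) (.refl _) (.var hx)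
      (.refl (n := 0) hA hA (.refl _))⟩
  | tAbs _ ih =>
    obtain ⟨hΓ, n, K', h⟩ := ih
    exact ⟨hΓ.1, _, _, .lam (.lam h.left) (.lam h.right) (.refl _) (.refl _) h⟩
  | tApp _ hk ih =>
    obtain ⟨hΓ, n, K', h⟩ := ih
    cases hk.simple.2 with
    | app h₁ h₂ =>
      obtain rfl := h.left.unique h₁
      obtain ⟨m, hm⟩ := h.app h₂
      exact ⟨hΓ, m, _, hm⟩
  | arrow _ _ hk ih₁ ih₂ =>
    obtain ⟨hΓ, n, K₁, h₁⟩ := ih₁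
    obtain ⟨-, m, K₂, h₂⟩ := ih₂
    cases hk.simple.2 with
    | arrow k₁ k₂ =>
      obtain rfl := h₁.right.unique k₁
      obtain rfl := h₂.left.unique k₂
      exact ⟨hΓ, _, _, .arrow (.arrow k₁ k₂) (.arrow h₁.left h₂.right) (.refl _) (.refl _) h₁ h₂⟩
  | all _ hk ih =>
    obtain ⟨hΓ, n, K', h⟩ := ih
    cases hk.simple.2 with
    | all k₁ k₂ =>
      obtain rfl := h.left.unique k₂
      exact ⟨hΓ.1, _, _, .all (.all k₁ k₂) (.all k₁ h.right) k₁ (.refl _) (.refl _) h⟩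

/-- This turns the erased equality premises of the Church-style rules into β-conversions. -/
theorem Sub.antisymm {Γ : Ctx} {A B : Ty} (h : Sub Γ A B) (h' : Sub Γ B A) : BetaEq A B := by
  obtain ⟨hΓ, n, K, h₁⟩ := h.le
  obtain ⟨-, m, K', h₂⟩ := h'.le
  obtain rfl := h₁.left.unique h₂.right
  exact h₁.antisymm hΓ h₂

end FOmegaSub.Curry

namespace FOmegaSub

/-! ### Erasure -/

namespace Church

theorem Ty.erase_rename (A : Ty) (ρ : ℕ → ℕ) : (A.rename ρ).erase = A.erase.rename ρ := by
  have lift (ρ : ℕ → ℕ) : liftRen ρ = Curry.liftRen ρ := by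
    funext x; cases x <;> rfl
  induction A generalizing ρ <;> simp_all [Ty.rename, Ty.erase, Curry.Ty.rename]

theorem Ty.erase_shift (A : Ty) : A.shift.erase = A.erase.shift := A.erase_rename _

/-- Erasure of a parallel substitution. -/
def PSubst.erase (γ : PSubst) (x : ℕ) : Curry.Ty := (γ x).elim .var Ty.erase

theorem PSubst.erase_lift (γ : PSubst) : γ.lift.erase = Curry.liftSubst γ.erase := by
  funext x
  cases x with
  | zero => rfl
  | succ x =>
    simp only [PSubst.erase, PSubst.lift, Curry.liftSubst]
    cases γ x with
    | inl y => rfl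
    | inr B => exact B.erase_shift

theorem Ty.erase_subst (A : Ty) (γ : PSubst) : (A.subst γ).erase = A.erase.subst γ.erase := by
  induction A generalizing γ with
  | var x A =>
    simp only [Ty.subst, Ty.erase, Curry.Ty.subst, PSubst.erase]
    cases γ x <;> rfl
  | _ => simp_all [Ty.subst, Ty.erase, Curry.Ty.subst, PSubst.erase_lift]

theorem Ty.erase_inst (A B : Ty) : (A.inst B).erase = A.erase.inst B.erase := by
  rw [Ty.inst, Ty.erase_subst, Curry.Ty.inst]
  congr 1
  funext x
  cases x <;> rfl

theorem erase_topAt (K : Kind) : (topAt K).erase = Curry.topAt K := by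
  induction K with
  | star => rfl
  | arr K K' _ ih => rw [topAt, Ty.erase, ih, Curry.topAt]

theorem Declares.erase {Γ : Ctx} {x : ℕ} {A : Ty} {K : Kind} (h : Declares Γ x A K) :
    Curry.Declares (Ctx.erase Γ) x A.erase K := by
  induction h with
  | here => rw [Ty.erase_shift]; exact .here
  | there _ ih => rw [Ty.erase_shift]; exact .there ih

theorem erase_cons_topAt (Γ : Ctx) (K : Kind) :
    Ctx.erase ((topAt K, K) :: Γ) = (Curry.topAt K, K) :: Ctx.erase Γ := by
  rw [← erase_topAt]; rfl

/-- The statement of the traditional system that erasure assigns to a Church-style statement. -/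
def Stmt.ErasedHolds (Γ : Curry.Ctx) : Stmt → Prop
  | .kind A K => Curry.HasKind Γ A.erase K
  | .sub A B K => Curry.Sub Γ A.erase B.erase ∧ Curry.HasKind Γ A.erase K ∧
      Curry.HasKind Γ B.erase K

end Church

/-! ### Church-style rules admissible in the traditional system -/

namespace Curry

theorem HasKind.wf {Γ : Ctx} {A : Ty} {K : Kind} (h : HasKind Γ A K) : HasKind Γ .top .star :=
  h.simple.1.hasKind .top

theorem HasKind.topAt {Γ : Ctx} (h : HasKind Γ .top .star) (K : Kind) :
    HasKind Γ (topAt K) K :=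
  h.simple.1.hasKind (.topAt _ _)

theorem HasKind.inst {Γ : Ctx} {A B : Ty} {K K' : Kind}
    (hA : HasKind ((Curry.topAt K, K) :: Γ) A K') (hB : HasKind Γ B K) : HasKind Γ (A.inst B) K' :=
  hB.simple.1.hasKind (hA.simple.2.inst hB.simple.2)

/-- The kind of `B` depends only on the kind of the bound, so `A` and `C` need not be related by
subtyping. -/
theorem HasKind.narrow {Γ : Ctx} {A C B : Ty} {K K' : Kind} (h : HasKind ((A, K) :: Γ) B K')
    (hC : HasKind Γ C K) : HasKind ((C, K) :: Γ) B K' :=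
  Ctx.Wf.hasKind (Γ := (C, K) :: Γ) hC.simple h.simple.2

/-- The function changes first, with the argument `B` fixed; antisymmetry then allows `B` to be
converted to `D`. -/
theorem Sub.app {Γ : Ctx} {A B C D : Ty} {K K' : Kind} (hAC : Sub Γ A C)
    (hA : HasKind Γ A (.arr K K')) (hC : HasKind Γ C (.arr K K')) (hB : HasKind Γ B K)
    (hD : HasKind Γ D K) (hBD : Sub Γ B D) (hDB : Sub Γ D B) : Sub Γ (.app A B) (.app C D) :=
  .trans (.tApp hAC (.tApp hA hB))
    (.conv (.tApp hC hB) (.tApp hC hD) (.app (.refl _) (hBD.antisymm hDB)))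

theorem Sub.all_of_eq {Γ : Ctx} {A B C D : Ty} {K : Kind} (hBD : Sub ((A, K) :: Γ) B D)
    (hB : HasKind ((A, K) :: Γ) B .star) (hD : HasKind ((A, K) :: Γ) D .star)
    (hC : HasKind Γ C K) (hAC : Sub Γ A C) (hCA : Sub Γ C A) :
    Sub Γ (.all A K B) (.all C K D) :=
  .trans (.all hBD (.all hB))
    (.conv (.all hD) (.all (hD.narrow hC)) (.all (hAC.antisymm hCA) (.refl _)))

end Curry

namespace Church

theorem Derives.erase {Γ : Ctx} {s : Stmt} (h : Derives Γ s) : s.ErasedHolds (Ctx.erase Γ) := by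
  induction h with
  | topEmp => exact .topEmp
  | topExt _ ih => exact .topExt ih
  | tVar _ _ hx ih => exact .tVar ih.wf hx.erase
  | tAbs _ ih => rw [erase_cons_topAt] at ih; exact .tAbs ih
  | tApp _ _ ih₁ ih₂ => exact .tApp ih₁ ih₂
  | arrow _ _ ih₁ ih₂ => exact .arrow ih₁ ih₂
  | all _ ih => exact .all ih
  | sRefl _ ih => exact ⟨.conv ih ih (.refl _), ih, ih⟩
  | sTrans _ _ ih₁ ih₂ => exact ⟨.trans ih₁.1 ih₂.1, ih₁.2.1, ih₂.2.2⟩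
  | sTop _ ih =>
    refine ⟨?_, ih, ?_⟩ <;> rw [erase_topAt]
    · exact .top ih
    · exact ih.wf.topAt _
  | sTVar _ _ _ hx ih₁ =>
    -- Both sides erase to the same variable, so the equality of the carried bounds plays no role.
    have h := Curry.HasKind.tVar ih₁.2.1.wf hx.erase
    exact ⟨.conv h h (.refl _), h, h⟩
  | sPromote _ _ hx ih₁ ih₂ =>
    exact ⟨.trans (.tVar ih₂.wf hx.erase) ih₁.1, .tVar ih₂.wf hx.erase, ih₂⟩
  | sTAbs _ ih =>
    rw [erase_cons_topAt] at ih
    exact ⟨.tAbs ih.1, .tAbs ih.2.1, .tAbs ih.2.2⟩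
  | sTApp _ _ _ ih₁ ih₂ ih₃ =>
    exact ⟨.app ih₁.1 ih₁.2.1 ih₁.2.2 ih₂.2.1 ih₂.2.2 ih₂.1 ih₃.1,
      .tApp ih₁.2.1 ih₂.2.1, .tApp ih₁.2.2 ih₂.2.2⟩
  | sArrow _ _ ih₁ ih₂ =>
    exact ⟨.arrow ih₁.1 ih₂.1 (.arrow ih₁.2.2 ih₂.2.1), .arrow ih₁.2.2 ih₂.2.1,
      .arrow ih₁.2.1 ih₂.2.2⟩
  | sAll _ _ _ ih₁ ih₂ ih₃ =>
    exact ⟨.all_of_eq ih₃.1 ih₃.2.1 ih₃.2.2 ih₁.2.2 ih₁.1 ih₂.1, .all ih₃.2.1,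
      .all (Curry.HasKind.narrow ih₃.2.2 ih₁.2.2)⟩
  | sBetaL _ _ ih₁ ih₂ =>
    rw [erase_cons_topAt] at ih₁
    rw [Stmt.ErasedHolds, Ty.erase_inst]
    have h := Curry.HasKind.inst ih₁ ih₂
    have h' := Curry.HasKind.tApp (.tAbs ih₁) ih₂
    exact ⟨.conv h' h (.beta _ _ _), h', h⟩
  | sBetaR _ _ ih₁ ih₂ =>
    rw [erase_cons_topAt] at ih₁
    rw [Stmt.ErasedHolds, Ty.erase_inst]
    have h := Curry.HasKind.inst ih₁ ih₂
    have h' := Curry.HasKind.tApp (.tAbs ih₁) ih₂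
    exact ⟨.conv h h' (Curry.BetaEq.beta _ _ _).symm, h, h'⟩

end Church

end FOmegaSub

theorem mainTheorem10 :
    (∀ (Γ : FOmegaSub.Church.Ctx) (A : FOmegaSub.Church.Ty) (K : FOmegaSub.Kind),
      FOmegaSub.Church.HasKind Γ A K →
        FOmegaSub.Curry.HasKind (FOmegaSub.Church.Ctx.erase Γ) A.erase K) ∧
    (∀ (Γ : FOmegaSub.Church.Ctx) (A B : FOmegaSub.Church.Ty) (K : FOmegaSub.Kind),
      FOmegaSub.Church.Sub Γ A B K →
        FOmegaSub.Curry.Sub (FOmegaSub.Church.Ctx.erase Γ) A.erase B.erase ∧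
        FOmegaSub.Curry.HasKind (FOmegaSub.Church.Ctx.erase Γ) A.erase K ∧
        FOmegaSub.Curry.HasKind (FOmegaSub.Church.Ctx.erase Γ) B.erase K) :=
  ⟨fun _ _ _ h => h.erase, fun _ _ _ _ h => h.erase⟩
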